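/- Let $E\in\{\mathscr D,\mathscr S\}$, where $\mathscr D=\mathscr D(\mathbb R^n)$ is the space of complex-valued $C^\infty$ functions on $\mathbb R^n$ with compact support, with its strict inductive limit topology, and $\mathscr S=\mathscr S(\mathbb R^n)$ is the Schwartz space of complex-valued rapidly decreasing $C^\infty$ functions with its Fréchet topology. Let $E'$ be the space of continuous linear functionals $E\to\mathbb C$. The support of $f\in E'$ is the complement of the union of all open $G\subset\mathbb R^n$ such that $f(\xi)=0$ for every $\xi\in E$ with $\operatorname{supp}\xi\subset G$. Let $C(0)$ be the set of $\gamma:\mathbb C\to\mathbb C$ with $\lim_{t\to0}\gamma(t)=\gamma(0)=0$ and $|\gamma(t)|\ge|t|$ for $|t|\le1$. For $\gamma\in C(0)$ and a neighbourhood $U$ of $0$ in $E$, let $E^{(\gamma,U)}$ be the set of continuous $g:E\to\mathbb C$ such that $g(0)=0$ and, for all $\xi\in E$, $\eta\in U$ and $t\in\mathbb C$ with $|t|\le1$, there are $r,s\in\mathbb C$ with $|r-1|\le|\gamma(t)|$, $|s|\le|\gamma(t)|$ and $g(\xi+t\eta)=r\,g(\xi)+s\,g(\eta)$. A functional $f_0\in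 E'$ is a convolution multiplier on $E$ if for every $\xi\in E$ the function $f_0*\xi:\mathbb R^n\to\mathbb C$, $(f_0*\xi)(x)=f_0(\xi(x+\cdot))$, belongs to $E$, and $f_0*\xi_k\to0$ in $E$ whenever $\xi_k\to0$ in $E$. For such $f_0$ and $g:E\to\mathbb C$ define $f_0*g:E\to\mathbb C$ by $(f_0*g)(\xi)=g(f_0*\xi)$. **Theorem 4.6.** Let $(f_k)_{k\in\mathbb N}$ be a sequence in $E'$ and $f:E\to\mathbb C$ a function with $f_k(\xi)\to f(\xi)$ for every $\xi\in E$, and suppose that there is a bounded set $F\subset\mathbb R^n$ with $\operatorname{supp}f_k\subseteq F$ for all $k$. Let $\gamma\in C(0)$, let $U$ be a neighbourhood of $0$ in $E$, and let $g,g_k\in E^{(\gamma,U)}$ ($k\in\mathbb N$) with $g_k(\xi)\to g(\xi)$ for every $\xi\in E$. Then $f\in E'$, all $f_k$ and $f$ are convolution multipliers on $E$, and: 1. for every bounded $B\subset E$, $\lim_{k,m\to\infty}(f_k*g_m)(\xi)=(f*g)(\xi)$ uniformly for $\xi\in B$; 2. in particular, for every bounded $B\subset E$, $\lim_{k\to\infty}(f_k*g_k)(\xi)=(f*g)(\xi)$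 uniformly for $\xi\in B$; 3. $(f_k*g_k)(\xi_k)\to(f*g)(\xi)$ whenever $\xi_k\to\xi$ in $E$. -/

import Mathlib

open Filter Topology TopologicalSpace
open scoped Distributions SchwartzMap

namespace DemiDist

/-- Euclidean space `ℝⁿ`. -/
abbrev Rn (n : ℕ) : Type := EuclideanSpace ℝ (Fin n)

/-- The space of complex-valued smooth compactly supported functions on `ℝⁿ`, with its
(locally convex, strict) inductive limit topology. -/
abbrev SpaceD (n : ℕ) : Type := 𝓓((⊤ : Opens (Rn n)), ℂ)

/-- The space of complex-valued rapidly decreasing smooth functions on `ℝⁿ`, with its Fréchet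
topology. -/
abbrev SpaceS (n : ℕ) : Type := 𝓢(Rn n, ℂ)

/-! ### Demi-linear maps and demi-distributions -/

/-- The class `C(0)` of moduli: `γ : ℂ → ℂ` with `lim_{t → 0} γ t = γ 0 = 0` and `|t| ≤ |γ t|`
for `|t| ≤ 1`. -/
def C0 : Set (ℂ → ℂ) :=
  {γ | γ 0 = 0 ∧ Tendsto γ (𝓝 0) (𝓝 0) ∧ ∀ t : ℂ, ‖t‖ ≤ 1 → ‖t‖ ≤ ‖γ t‖}

/-- The family `𝓛_{γ,U}(X, Y)` of demi-linear maps. -/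
def demiLinear {X Y : Type*} [AddCommGroup X] [Module ℂ X] [AddCommGroup Y] [Module ℂ Y]
    (γ : ℂ → ℂ) (U : Set X) : Set (X → Y) :=
  {f | f 0 = 0 ∧ ∀ x : X, ∀ u ∈ U, ∀ t : ℂ, ‖t‖ ≤ 1 →
    ∃ r s : ℂ, ‖r - 1‖ ≤ ‖γ t‖ ∧ ‖s‖ ≤ ‖γ t‖ ∧ f (x + t • u) = r • f x + s • f u}

/-- The family `E^{(γ,U)}` of demi-distributions: the continuous members of `𝓛_{γ,U}(E, ℂ)`. -/
def demiDistributions {E : Type*} [AddCommGroup E] [Module ℂ E] [TopologicalSpace E]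
    (γ : ℂ → ℂ) (U : Set E) : Set (E → ℂ) :=
  {f | Continuous f ∧ f ∈ demiLinear γ U}

/-! ### Translations of test functions -/

/-- A space of functions on `ℝⁿ` that contains, with `ξ`, all its translates `ξ(x + ·)`. -/
class TranslationSpace (n : outParam ℕ) (E : Type) [FunLike E (Rn n) ℂ] where
  /-- The translate `ξ(x + ·)`. -/
  translate : Rn n → E → E
  translate_apply : ∀ (x : Rn n) (ξ : E) (y : Rn n), translate x ξ y = ξ (x + y)

noncomputable instance (n : ℕ) : TranslationSpace n (SpaceD n) where
  translate x ξ :=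
    { toFun := fun y => ξ (x + y)
      contDiff' := ξ.contDiff.comp (contDiff_const.add contDiff_id)
      hasCompactSupport' := ξ.hasCompactSupport.comp_homeomorph (Homeomorph.addLeft x)
      tsupport_subset' := fun _ _ => trivial }
  translate_apply _ _ _ := rfl

noncomputable instance (n : ℕ) : TranslationSpace n (SpaceS n) where
  translate x ξ := SchwartzMap.compSubConstCLM ℂ (-x) ξ
  translate_apply x ξ y := by
    rw [SchwartzMap.compSubConstCLM_apply, sub_neg_eq_add, add_comm]

/-! ### Convolution -/

section Convolution

variable {n : ℕ} {E : Type} [FunLike E (Rn n) ℂ] [AddCommGroup E] [Module ℂ E]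
  [TopologicalSpace E] [TranslationSpace n E]

/-- A distribution `f₀ ∈ E'` is a convolution multiplier on `E` if for every `ξ ∈ E` the function
`f₀ ∗ ξ : x ↦ f₀ (ξ(x + ·))` is in `E`, and `f₀ ∗ ξₖ → 0` in `E` whenever `ξₖ → 0` in `E`. -/
structure IsConvolutionMultiplier (f₀ : E →L[ℂ] ℂ) : Prop where
  exists_eq : ∀ ξ : E, ∃ ζ : E, ∀ x : Rn n, ζ x = f₀ (TranslationSpace.translate x ξ)
  tendsto_zero : ∀ ξ ζ : ℕ → E,
    (∀ k, ∀ x : Rn n, ζ k x = f₀ (TranslationSpace.translate x (ξ k))) →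
      Tendsto ξ atTop (𝓝 0) → Tendsto ζ atTop (𝓝 0)

/-- The test function `f₀ ∗ ξ`, for a convolution multiplier `f₀`. -/
noncomputable def IsConvolutionMultiplier.convTest {f₀ : E →L[ℂ] ℂ}
    (h : IsConvolutionMultiplier f₀) (ξ : E) : E :=
  (h.exists_eq ξ).choose

theorem IsConvolutionMultiplier.convTest_apply {f₀ : E →L[ℂ] ℂ}
    (h : IsConvolutionMultiplier f₀) (ξ : E) (x : Rn n) :
    h.convTest ξ x = f₀ (TranslationSpace.translate x ξ) :=
  (h.exists_eq ξ).choose_spec x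

/-- The convolution `f₀ ∗ g : E → ℂ`, `(f₀ ∗ g)(ξ) = g (f₀ ∗ ξ)`, of a convolution multiplier
`f₀` and a function `g` on `E`. -/
noncomputable def IsConvolutionMultiplier.conv {f₀ : E →L[ℂ] ℂ}
    (h : IsConvolutionMultiplier f₀) (g : E → ℂ) : E → ℂ :=
  fun ξ => g (h.convTest ξ)

end Convolution

end DemiDist

open DemiDist

/-! The supports lie in one ball, so a cutoff `χ` equal to 1 near that ball lets every `fk k` be
read as a functional `T k = fk k ∘ P` on the Schwartz space, where `P` is multiplication by `χ`
followed by passage to `E`. The Schwartz space is Fréchet, hence Banach-Steinhaus makes the limit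
continuous and bounds all `T k` by one continuous seminorm. A second cutoff turns this into a bound
by finitely many derivatives on one ball (`IsLocalBound`). Such bounds make `x ↦ T (φ (x + ·))` a
Schwartz function, with seminorms controlled uniformly in `T`. Bounded sequences that converge
pointwise converge in the Schwartz space, so `fk k ∗ ξk k → f ∗ ξ` whenever `ξk → ξ`
(`tendsto_conv`, `exists_tendsto_conv`).

On the side of `gk`, demi-linearity is strong enough for the Baire category argument: pointwise
bounded families on a Baire space are equicontinuous (`eventually_norm_sub_lt`). The space `𝓓` need
not be Baire, but a convergent sequence in it, and its convolutions, are supported in one ball. They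
therefore live in a closed subspace of the Schwartz space, and `gk` is restricted to that subspace.
`SchwartzModel` isolates what is used, so that `𝓓` and `𝓢` share one proof.

Together these give convergence along sequences, even when the two indices tend to infinity
independently. Uniformity on bounded sets follows by contradiction: the Montel property extracts a
convergent subsequence from a sequence of bad points. -/

/-! ### Taylor and Landau inequalities -/

section Taylor

variable {V W : Type*} [NormedAddCommGroup V] [NormedSpace ℝ V] [NormedAddCommGroup W]
  [NormedSpace ℝ W]

/-- First order Taylor estimate for a function with Lipschitz derivative. -/
theorem norm_taylor_remainder_le {f : V → W} {f' : V → V →L[ℝ] W} {M : ℝ}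
    (hf : ∀ x, HasFDerivAt f (f' x) x) (hM : ∀ x y, ‖f' x - f' y‖ ≤ M * ‖x - y‖) (x v : V) :
    ‖f (x + v) - f x - f' x v‖ ≤ M * ‖v‖ * ‖v‖ := by
  have hM0 : 0 ≤ M * ‖v‖ := by
    have := hM (x + v) x
    rw [add_sub_cancel_left] at this
    exact (norm_nonneg _).trans this
  have key := (convex_closedBall x ‖v‖).norm_image_sub_le_of_norm_hasFDerivWithin_le'
    (f := f) (f' := f') (φ := f' x) (C := M * ‖v‖) (x := x) (y := x + v)
    (fun y _ => (hf y).hasFDerivWithinAt) (fun y hy => ?_) (by simp) (by simp)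
  · simpa using key
  · refine (hM y x).trans ?_
    rw [Metric.mem_closedBall, dist_eq_norm] at hy
    by_cases hv : v = 0
    · subst hv
      simp only [norm_zero, norm_le_zero_iff] at hy
      simp [hy]
    · have : 0 ≤ M := nonneg_of_mul_nonneg_left hM0 (norm_pos_iff.2 hv)
      gcongr

/-- Landau's interpolation inequality: a bounded function with Lipschitz derivative has a
derivative controlled by the sup norm of the function. -/
theorem norm_fderiv_le_of_norm_le {f : V → W} {f' : V → V →L[ℝ] W} {a M h : ℝ}
    (hf : ∀ x, HasFDerivAt f (f' x) x) (ha : ∀ x, ‖f x‖ ≤ a)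
    (hM : ∀ x y, ‖f' x - f' y‖ ≤ M * ‖x - y‖) (hM0 : 0 ≤ M) (hh : 0 < h) (x : V) :
    ‖f' x‖ ≤ 2 * a / h + M * h := by
  have ha0 : 0 ≤ a := (norm_nonneg _).trans (ha x)
  refine ContinuousLinearMap.opNorm_le_of_unit_norm (by positivity) fun v hv => ?_
  -- Solving the Taylor estimate with increment `h • v` for its linear term costs `2 * a + M * h *
  -- h`; then divide by `h`.
  have h1 := norm_taylor_remainder_le hf hM x (h • v)
  rw [norm_smul, hv, mul_one, Real.norm_of_nonneg hh.le, map_smul] at h1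
  have h2 : ‖h • f' x v‖ ≤ ‖f (x + h • v) - f x - h • f' x v‖ + ‖f (x + h • v)‖ + ‖f x‖ := by
    have : h • f' x v = -(f (x + h • v) - f x - h • f' x v) + f (x + h • v) - f x := by abel
    rw [this]
    refine (norm_sub_le _ _).trans ?_
    gcongr
    refine (norm_add_le _ _).trans ?_
    rw [norm_neg, ← this]
  rw [norm_smul, Real.norm_of_nonneg hh.le] at h2
  have h3 : h * ‖f' x v‖ ≤ M * h * h + 2 * a := by linarith [ha (x + h • v), ha x]
  rw [← mul_le_mul_iff_right₀ hh]
  refine h3.trans (le_of_eq ?_)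
  field_simp
  ring

end Taylor

/-! ### Completeness and the Montel property of the Schwartz space -/

namespace SchwartzMap

variable {V F : Type*} [NormedAddCommGroup V] [NormedSpace ℝ V] [NormedAddCommGroup F]
  [NormedSpace ℝ F]

theorem hasFDerivAt_iteratedFDeriv (φ : 𝓢(V, F)) (i : ℕ) (x : V) :
    HasFDerivAt (iteratedFDeriv ℝ i φ) (fderiv ℝ (iteratedFDeriv ℝ i φ) x) x :=
  ((φ.smooth ⊤).differentiable_iteratedFDeriv (by exact_mod_cast WithTop.coe_lt_top _)
    x).hasFDerivAt

theorem norm_iteratedFDeriv_sub_le (φ : 𝓢(V, F)) (i : ℕ) (x y : V) :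
    ‖iteratedFDeriv ℝ i φ x - iteratedFDeriv ℝ i φ y‖ ≤
      SchwartzMap.seminorm ℝ 0 (i + 1) φ * ‖x - y‖ := by
  refine convex_univ.norm_image_sub_le_of_norm_hasFDerivWithin_le
    (fun z _ => (φ.hasFDerivAt_iteratedFDeriv i z).hasFDerivWithinAt) (fun z _ => ?_)
    (Set.mem_univ y) (Set.mem_univ x)
  rw [norm_fderiv_iteratedFDeriv]
  exact φ.norm_iteratedFDeriv_le_seminorm ℝ (i + 1) z

theorem norm_fderiv_iteratedFDeriv_sub_le (φ : 𝓢(V, F)) (i : ℕ) (x y : V) :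
    ‖fderiv ℝ (iteratedFDeriv ℝ i φ) x - fderiv ℝ (iteratedFDeriv ℝ i φ) y‖ ≤
      SchwartzMap.seminorm ℝ 0 (i + 2) φ * ‖x - y‖ := by
  rw [fderiv_iteratedFDeriv]
  have e : (continuousMultilinearCurryLeftEquiv ℝ (fun _ : Fin (i + 1) => V) F ∘
      iteratedFDeriv ℝ (i + 1) φ) x - (continuousMultilinearCurryLeftEquiv ℝ (fun _ => V) F ∘
      iteratedFDeriv ℝ (i + 1) φ) y =
      (iteratedFDeriv ℝ (i + 1) φ x - iteratedFDeriv ℝ (i + 1) φ y).curryLeft := rfl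
  rw [e, ContinuousMultilinearMap.curryLeft_norm]
  exact φ.norm_iteratedFDeriv_sub_le (i + 1) x y

theorem iteratedFDeriv_sub_apply' (φ ψ : 𝓢(V, F)) (i : ℕ) (x : V) :
    iteratedFDeriv ℝ i (φ - ψ) x = iteratedFDeriv ℝ i φ x - iteratedFDeriv ℝ i ψ x := by
  rw [FunLike.coe_sub, iteratedFDeriv_sub_apply ((φ.smooth i).contDiffAt) ((ψ.smooth i).contDiffAt)]

/-- If a family of Schwartz functions is bounded and converges to zero uniformly, then so do all
derivatives. This is the interpolation step in the Montel property. -/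
theorem norm_iteratedFDeriv_succ_le (φ : 𝓢(V, F)) (i : ℕ) {a M h : ℝ}
    (ha : ∀ x, ‖iteratedFDeriv ℝ i φ x‖ ≤ a) (hM : SchwartzMap.seminorm ℝ 0 (i + 2) φ ≤ M)
    (hh : 0 < h) (x : V) : ‖iteratedFDeriv ℝ (i + 1) φ x‖ ≤ 2 * a / h + M * h := by
  rw [← norm_fderiv_iteratedFDeriv]
  refine norm_fderiv_le_of_norm_le (φ.hasFDerivAt_iteratedFDeriv i) ha (fun y z => ?_)
    ((apply_nonneg _ _).trans hM) hh x
  refine (φ.norm_fderiv_iteratedFDeriv_sub_le i y z).trans ?_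
  gcongr

/-- Evaluation of Schwartz functions at a point, as a continuous linear map. -/
noncomputable def evalPointCLM (x : V) : 𝓢(V, F) →L[ℝ] F :=
  (BoundedContinuousFunction.evalCLM ℝ x).comp (toBoundedContinuousFunctionCLM ℝ V F)

theorem evalPointCLM_apply (x : V) (φ : 𝓢(V, F)) : evalPointCLM x φ = φ x := rfl

theorem bounded_seminorm_of_cauchySeq {φ : ℕ → 𝓢(V, F)} (hφ : CauchySeq φ) (k i : ℕ) :
    ∃ C, ∀ j, SchwartzMap.seminorm ℝ k i (φ j) ≤ C := by
  have h := (schwartz_withSeminorms ℝ V F).isVonNBounded_iff_seminorm_bounded.1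
    (hφ.totallyBounded_range.isVonNBounded ℝ) (k, i)
  obtain ⟨r, -, hr⟩ := h
  exact ⟨r, fun j => (hr _ (Set.mem_range_self j)).le⟩

variable [ProperSpace V]

/-- A bounded sequence of Schwartz functions that is pointwise Cauchy on a dense set is uniformly
Cauchy. -/
theorem exists_forall_norm_sub_le {φ : ℕ → 𝓢(V, F)}
    (hb : ∀ k i, ∃ C, ∀ j, SchwartzMap.seminorm ℝ k i (φ j) ≤ C) {D : Set V} (hD : Dense D)
    (hc : ∀ x ∈ D, CauchySeq fun j => φ j x) {ε : ℝ} (hε : 0 < ε) :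
    ∃ N, ∀ p ≥ N, ∀ q ≥ N, ∀ x, ‖φ p x - φ q x‖ ≤ ε := by
  obtain ⟨C, hC⟩ := hb 1 0
  obtain ⟨M, hM⟩ := hb 0 1
  have hC0 : 0 ≤ C := (apply_nonneg _ _).trans (hC 0)
  have hM0 : 0 ≤ M := (apply_nonneg _ _).trans (hM 0)
  -- Outside radius `R` the bound on `‖x‖ * ‖φ j x‖` makes each value at most `ε / 2`. Inside, a
  -- finite `δ`-net of points of `D` and the common Lipschitz constant `M` suffice. The added ones
  -- keep `R` and `δ` positive and finite when `C` or `M` is 0.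
  set R : ℝ := 2 * C / ε + 1
  have hR : 0 < R := by positivity
  set δ : ℝ := ε / (3 * (M + 1))
  have hδ : 0 < δ := by positivity
  have lip : ∀ j x y, ‖φ j x - φ j y‖ ≤ M * ‖x - y‖ := by
    intro j x y
    refine (convex_univ.norm_image_sub_le_of_norm_hasFDerivWithin_le (𝕜 := ℝ)
      (fun z _ => ((φ j).hasFDerivAt z).hasFDerivWithinAt) (fun z _ => ?_)
      (Set.mem_univ y) (Set.mem_univ x))
    rw [← norm_iteratedFDeriv_one]
    exact ((φ j).norm_iteratedFDeriv_le_seminorm ℝ 1 z).trans (hM j)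
  obtain ⟨t, htD, ht⟩ := (isCompact_closedBall (0 : V) R).elim_finite_subcover_image
    (b := D) (c := fun d => Metric.ball d δ) (fun _ _ => Metric.isOpen_ball) (fun x _ => by
      obtain ⟨d, hd, hxd⟩ := hD.exists_dist_lt x hδ
      exact Set.mem_biUnion hd hxd)
  have hN : ∀ d ∈ t, ∃ N, ∀ p ≥ N, ∀ q ≥ N, ‖φ p d - φ q d‖ ≤ ε / 3 := by
    intro d hd
    obtain ⟨N, hN⟩ := Metric.cauchySeq_iff.1 (hc d (htD hd)) (ε / 3) (by positivity)
    exact ⟨N, fun p hp q hq => by rw [← dist_eq_norm]; exact (hN p hp q hq).le⟩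
  choose! N hN using hN
  obtain ⟨N₀, hN₀⟩ : ∃ N₀, ∀ d ∈ t, N d ≤ N₀ :=
    ⟨ht.1.toFinset.sup N, fun d hd => Finset.le_sup (f := N) (ht.1.mem_toFinset.2 hd)⟩
  refine ⟨N₀, fun p hp q hq x => ?_⟩
  by_cases hx : ‖x‖ ≤ R
  · obtain ⟨d, hd, hxd⟩ := Set.mem_iUnion₂.1 (ht.2 (mem_closedBall_zero_iff.2 hx))
    rw [Metric.mem_ball, dist_eq_norm] at hxd
    have e : φ p x - φ q x = (φ p x - φ p d) + (φ p d - φ q d) + -(φ q x - φ q d) := by abel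
    have hMδ : M * ‖x - d‖ ≤ ε / 3 := by
      have : M * δ ≤ ε / 3 := by
        simp only [δ]
        rw [mul_div_assoc', div_le_div_iff₀ (by positivity) (by positivity)]
        nlinarith
      exact (by gcongr : M * ‖x - d‖ ≤ M * δ).trans this
    rw [e]
    refine (norm_add₃_le).trans ?_
    rw [norm_neg]
    linarith [lip p x d, lip q x d,
      hN d hd p ((hN₀ d hd).trans hp) q ((hN₀ d hd).trans hq)]
  · push Not at hx
    have dec : ∀ j, ‖φ j x‖ ≤ ε / 2 := by
      intro j
      have h1 := ((φ j).norm_pow_mul_le_seminorm ℝ 1 x).trans (hC j)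
      rw [pow_one] at h1
      have h2 : R * ‖φ j x‖ ≤ C := le_trans (by gcongr) h1
      have h3 : C ≤ R * (ε / 2) := by
        simp only [R]
        have : (2 * C / ε + 1) * (ε / 2) = C + ε / 2 := by field_simp
        linarith
      exact le_of_mul_le_mul_left (h2.trans h3) hR
    refine (norm_sub_le _ _).trans ?_
    linarith [dec p, dec q]

/-- A bounded sequence of Schwartz functions that is pointwise Cauchy on a dense set converges in
the Schwartz space. -/
theorem exists_tendsto_of_cauchySeq_apply [CompleteSpace F] {φ : ℕ → 𝓢(V, F)}
    (hb : ∀ k i, ∃ C, ∀ j, SchwartzMap.seminorm ℝ k i (φ j) ≤ C) {D : Set V} (hD : Dense D)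
    (hc : ∀ x ∈ D, CauchySeq fun j => φ j x) : ∃ ψ, Tendsto φ atTop (𝓝 ψ) := by
  -- Uniform Cauchyness passes from order `i` to order `i + 1` by Landau's inequality, since order
  -- `i + 2` stays bounded.
  have cau : ∀ i : ℕ, ∀ ε > 0, ∃ N, ∀ p ≥ N, ∀ q ≥ N, ∀ x,
      ‖iteratedFDeriv ℝ i (φ p) x - iteratedFDeriv ℝ i (φ q) x‖ ≤ ε := by
    intro i
    induction i with
    | zero =>
      intro ε hε
      obtain ⟨N, hN⟩ := exists_forall_norm_sub_le hb hD hc hε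
      refine ⟨N, fun p hp q hq x => ?_⟩
      rw [← iteratedFDeriv_sub_apply', norm_iteratedFDeriv_zero]
      exact hN p hp q hq x
    | succ i ih =>
      intro ε hε
      obtain ⟨M, hM⟩ := hb 0 (i + 2)
      have hM0 : 0 ≤ M := (apply_nonneg _ _).trans (hM 0)
      -- A difference of two terms has seminorm at most `2 * M`. With this `h` the Lipschitz term is
      -- at most `ε / 2`, and the tolerance `ε * h / 4` makes the other term exactly `ε / 2`.
      set h : ℝ := ε / (4 * (M + 1))
      have hh : 0 < h := by positivity
      obtain ⟨N, hN⟩ := ih (ε * h / 4) (by positivity)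
      refine ⟨N, fun p hp q hq x => ?_⟩
      rw [← iteratedFDeriv_sub_apply']
      refine (norm_iteratedFDeriv_succ_le (φ p - φ q) i (a := ε * h / 4) (M := 2 * M)
        (fun y => ?_) ?_ hh x).trans ?_
      · rw [iteratedFDeriv_sub_apply']
        exact hN p hp q hq y
      · refine (map_sub_le_add _ _ _).trans ?_
        linarith [hM p, hM q]
      · have h1 : 2 * (ε * h / 4) / h = ε / 2 := by field_simp; norm_num
        have h2 : 2 * M * h ≤ ε / 2 := by
          simp only [h]
          rw [mul_div_assoc', div_le_div_iff₀ (by positivity) (by positivity)]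
          nlinarith
        linarith
  have lim : ∀ (i : ℕ) (x : V), ∃ L, Tendsto (fun p => iteratedFDeriv ℝ i (φ p) x) atTop (𝓝 L) := by
    intro i x
    refine cauchySeq_tendsto_of_complete (Metric.cauchySeq_iff.2 fun ε hε => ?_)
    obtain ⟨N, hN⟩ := cau i (ε / 2) (by positivity)
    refine ⟨N, fun p hp q hq => ?_⟩
    rw [dist_eq_norm]
    linarith [hN p hp q hq x]
  choose G hG using lim
  have unif : ∀ i : ℕ, ∀ ε > 0, ∃ N, ∀ p ≥ N, ∀ x, ‖iteratedFDeriv ℝ i (φ p) x - G i x‖ ≤ ε := by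
    intro i ε hε
    obtain ⟨N, hN⟩ := cau i ε hε
    exact ⟨N, fun p hp x => le_of_tendsto ((tendsto_const_nhds.sub (hG i x)).norm)
      (eventually_atTop.2 ⟨N, fun q hq => hN p hp q hq x⟩)⟩
  have der : ∀ (i : ℕ) (x : V), HasFDerivAt (G i) (G (i + 1) x).curryLeft x := by
    intro i x
    refine hasFDerivAt_of_tendstoUniformly (l := atTop) (f := fun p => iteratedFDeriv ℝ i (φ p))
      (f' := fun p y => (iteratedFDeriv ℝ (i + 1) (φ p) y).curryLeft)
      (g' := fun y => (G (i + 1) y).curryLeft) ?_ (fun p y => ?_) (fun y => hG i y) x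
    · refine Metric.tendstoUniformly_iff.2 fun ε hε => ?_
      obtain ⟨N, hN⟩ := unif (i + 1) (ε / 2) (by positivity)
      refine eventually_atTop.2 ⟨N, fun p hp y => ?_⟩
      have e : (G (i + 1) y).curryLeft - (iteratedFDeriv ℝ (i + 1) (φ p) y).curryLeft =
          (G (i + 1) y - iteratedFDeriv ℝ (i + 1) (φ p) y).curryLeft := rfl
      rw [dist_eq_norm, e, ContinuousMultilinearMap.curryLeft_norm, norm_sub_rev]
      linarith [hN p hp y]
    · have := (φ p).hasFDerivAt_iteratedFDeriv i y
      rw [fderiv_iteratedFDeriv] at this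
      exact this
  let f : V → F := fun x => (G 0 x).curry0
  have tay : HasFTaylorSeriesUpTo (⊤ : ℕ∞) f (fun x i => G i x) :=
    ⟨fun x => rfl, fun i _ x => der i x,
      fun i _ => continuous_iff_continuousAt.2 fun x => (der i x).continuousAt⟩
  have itf : ∀ i x, iteratedFDeriv ℝ i f x = G i x := fun i x =>
    (tay.eq_iteratedFDeriv (by exact_mod_cast le_top) x).symm
  let ψ : 𝓢(V, F) :=
    { toFun := f
      smooth' := tay.contDiff
      decay' := fun k i => by
        obtain ⟨C, hC⟩ := hb k i
        refine ⟨C, fun x => ?_⟩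
        rw [itf]
        exact le_of_tendsto ((hG i x).norm.const_mul _)
          (Eventually.of_forall fun p => ((φ p).le_seminorm ℝ k i x).trans (hC p)) }
  have hψ : ∀ i x, iteratedFDeriv ℝ i ψ x = G i x := itf
  refine ⟨ψ, ((schwartz_withSeminorms ℝ V F).tendsto_nhds_atTop φ ψ).2 ?_⟩
  rintro ⟨k, i⟩ ε hε
  rw [schwartzSeminormFamily_apply]
  -- One extra power of `‖x‖` makes the weighted tails small; on the remaining ball uniform
  -- convergence is enough.
  obtain ⟨C, hC⟩ := hb (k + 1) i
  have hC0 : 0 ≤ C := (apply_nonneg _ _).trans (hC 0)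
  have hCψ : SchwartzMap.seminorm ℝ (k + 1) i ψ ≤ C := by
    refine seminorm_le_bound ℝ _ _ _ hC0 fun x => ?_
    rw [hψ]
    exact le_of_tendsto ((hG i x).norm.const_mul _)
      (Eventually.of_forall fun p => ((φ p).le_seminorm ℝ (k + 1) i x).trans (hC p))
  set R : ℝ := 4 * C / ε + 1
  have hR : 0 < R := by positivity
  obtain ⟨N, hN⟩ := unif i (ε / (2 * R ^ k)) (by positivity)
  refine ⟨N, fun p hp => lt_of_le_of_lt (b := ε / 2) ?_ (by linarith)⟩
  refine seminorm_le_bound ℝ _ _ _ (by positivity) fun x => ?_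
  by_cases hx : ‖x‖ ≤ R
  · have h1 := hN p hp x
    rw [iteratedFDeriv_sub_apply', hψ]
    calc ‖x‖ ^ k * ‖iteratedFDeriv ℝ i (φ p) x - G i x‖
        ≤ R ^ k * (ε / (2 * R ^ k)) := by gcongr
      _ = ε / 2 := by field_simp
  · push Not at hx
    have h1 := (φ p - ψ).le_seminorm ℝ (k + 1) i x
    have h2 : SchwartzMap.seminorm ℝ (k + 1) i (φ p - ψ) ≤ 2 * C :=
      (map_sub_le_add _ _ _).trans (by linarith [hC p])
    have h3 : R * (‖x‖ ^ k * ‖iteratedFDeriv ℝ i (φ p - ψ) x‖) ≤ 2 * C := by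
      refine le_trans ?_ (h1.trans h2)
      rw [pow_succ', mul_assoc]
      gcongr
    have h4 : 2 * C ≤ R * (ε / 2) := by
      simp only [R]
      have : (4 * C / ε + 1) * (ε / 2) = 2 * C + ε / 2 := by field_simp; ring
      linarith
    exact le_of_mul_le_mul_left (h3.trans h4) hR

/-- A bounded sequence of Schwartz functions that converges pointwise to a Schwartz function
converges to it in the Schwartz space. -/
theorem tendsto_of_tendsto_apply [CompleteSpace F] {φ : ℕ → 𝓢(V, F)}
    (hb : ∀ k i, ∃ C, ∀ j, SchwartzMap.seminorm ℝ k i (φ j) ≤ C) {ψ : 𝓢(V, F)}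
    (hc : ∀ x, Tendsto (fun j => φ j x) atTop (𝓝 (ψ x))) : Tendsto φ atTop (𝓝 ψ) := by
  obtain ⟨χ, hχ⟩ := exists_tendsto_of_cauchySeq_apply hb dense_univ fun x _ => (hc x).cauchySeq
  have : χ = ψ := by
    ext x
    refine tendsto_nhds_unique ?_ (hc x)
    exact ((evalPointCLM x).continuous.tendsto χ).comp hχ
  rwa [← this]

/-- The **Montel property** of the Schwartz space: bounded sequences have convergent
subsequences. -/
theorem exists_subseq_tendsto [ProperSpace F] {φ : ℕ → 𝓢(V, F)}
    (hb : ∀ k i, ∃ C, ∀ j, SchwartzMap.seminorm ℝ k i (φ j) ≤ C) :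
    ∃ ψ, ∃ σ : ℕ → ℕ, StrictMono σ ∧ Tendsto (φ ∘ σ) atTop (𝓝 ψ) := by
  obtain ⟨C, hC⟩ := hb 0 0
  -- Tychonoff for the values on a countable dense sequence replaces the diagonal argument.
  have hK : IsCompact (Set.univ.pi fun _ : ℕ => Metric.closedBall (0 : F) C) :=
    isCompact_univ_pi fun _ => isCompact_closedBall _ _
  obtain ⟨a, -, σ, hσ, ha⟩ := hK.tendsto_subseq (x := fun j d => φ j (denseSeq V d))
    fun j d _ => mem_closedBall_zero_iff.2 (((φ j).norm_le_seminorm ℝ _).trans (hC j))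
  obtain ⟨ψ, hψ⟩ := exists_tendsto_of_cauchySeq_apply (φ := φ ∘ σ)
    (fun k i => (hb k i).imp fun C hC j => hC _) (denseRange_denseSeq V) (by
      rintro _ ⟨d, rfl⟩
      exact (tendsto_pi_nhds.1 ha d).cauchySeq)
  exact ⟨ψ, σ, hσ, hψ⟩

instance instCompleteSpace [CompleteSpace F] : CompleteSpace 𝓢(V, F) := by
  have : (uniformity 𝓢(V, F)).IsCountablyGenerated :=
    IsUniformAddGroup.uniformity_countably_generated
  refine UniformSpace.complete_of_cauchySeq_tendsto fun φ hφ => ?_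
  exact exists_tendsto_of_cauchySeq_apply (bounded_seminorm_of_cauchySeq hφ) dense_univ
    fun x _ => hφ.map (evalPointCLM (F := F) x).uniformContinuous

end SchwartzMap

/-! ### Convolution of locally bounded functionals with Schwartz functions -/

namespace SchwartzMap

section Commute

open LineDeriv

variable {V F : Type*} [NormedAddCommGroup V] [NormedSpace ℝ V] [NormedAddCommGroup F]
  [NormedSpace ℝ F]

theorem lineDerivOp_comm (φ : 𝓢(V, F)) (v w : V) : ∂_{v} (∂_{w} φ) = ∂_{w} (∂_{v} φ) := by
  ext x
  have hd : DifferentiableAt ℝ (fderiv ℝ φ) x :=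
    ((φ.smooth 2).fderiv_right (m := 1) (by norm_num)).differentiable (by norm_num) x
  have h : ∀ a b : V, (∂_{a} (∂_{b} φ) : 𝓢(V, F)) x = fderiv ℝ (fderiv ℝ φ) x a b := by
    intro a b
    rw [lineDerivOp_apply_eq_fderiv]
    have : ⇑(∂_{b} φ : 𝓢(V, F)) = fun y => fderiv ℝ φ y b := rfl
    rw [this, fderiv_clm_apply hd (differentiableAt_const b)]
    simp
  rw [h, h]
  exact (ContDiffAt.isSymmSndFDerivAt ((φ.smooth 2).contDiffAt) (by simp)).eq v w

theorem lineDerivOp_iteratedLineDerivOp_comm {i : ℕ} (φ : 𝓢(V, F)) (v : V) (m : Fin i → V) :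
    ∂_{v} (∂^{m} φ) = ∂^{m} (∂_{v} φ) := by
  induction i with
  | zero => simp
  | succ i ih =>
    rw [iteratedLineDerivOp_succ_left, iteratedLineDerivOp_succ_left, lineDerivOp_comm, ih]

/-- The new derivative is innermost on the left and outermost on the right, and symmetry of second
derivatives moves it through. This turns the convolution with `∂_{v} φ` into the linear term of a
Taylor expansion. -/
theorem iteratedFDeriv_lineDerivOp (φ : 𝓢(V, F)) (i : ℕ) (v x : V) :
    iteratedFDeriv ℝ i (∂_{v} φ : 𝓢(V, F)) x = fderiv ℝ (iteratedFDeriv ℝ i φ) x v := by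
  ext m
  have h := iteratedFDeriv_succ_apply_left (𝕜 := ℝ) (f := φ) (x := x) (Fin.cons v m : Fin (i + 1) → V)
  rw [Fin.cons_zero, Fin.tail_cons] at h
  rw [← h, ← iteratedLineDerivOp_eq_iteratedFDeriv, ← iteratedLineDerivOp_eq_iteratedFDeriv,
    iteratedLineDerivOp_succ_left, Fin.cons_zero, Fin.tail_cons,
    lineDerivOp_iteratedLineDerivOp_comm]

end Commute

section Shift

variable {V : Type*} [NormedAddCommGroup V] [NormedSpace ℝ V]

/-- The translate `φ (x + ·)` of a Schwartz function. -/
noncomputable def shift (x : V) : 𝓢(V, ℂ) →L[ℂ] 𝓢(V, ℂ) := compSubConstCLM ℂ (-x)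

theorem shift_apply (x : V) (φ : 𝓢(V, ℂ)) (y : V) : shift x φ y = φ (x + y) := by
  rw [shift, compSubConstCLM_apply, sub_neg_eq_add, add_comm]

theorem coe_shift (x : V) (φ : 𝓢(V, ℂ)) : ⇑(shift x φ) = fun y => φ (x + y) :=
  funext (shift_apply x φ)

theorem iteratedFDeriv_shift (x : V) (φ : 𝓢(V, ℂ)) (i : ℕ) (y : V) :
    iteratedFDeriv ℝ i (shift x φ) y = iteratedFDeriv ℝ i φ (x + y) := by
  rw [coe_shift, iteratedFDeriv_comp_add_left]

end Shift

section Local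

open LineDeriv

variable {V : Type*} [NormedAddCommGroup V] [NormedSpace ℝ V]

/-- A tempered functional `T` is bounded, with constant `C`, by the sup norms over the ball of
radius `R` of the derivatives up to order `N`. -/
def IsLocalBound (T : 𝓢(V, ℂ) →L[ℂ] ℂ) (C : ℝ) (N : ℕ) (R : ℝ) : Prop :=
  ∀ (φ : 𝓢(V, ℂ)) (B : ℝ), 0 ≤ B →
    (∀ i ≤ N, ∀ y, ‖y‖ ≤ R → ‖iteratedFDeriv ℝ i φ y‖ ≤ B) → ‖T φ‖ ≤ C * B

theorem IsLocalBound.of_tendsto {T : ℕ → 𝓢(V, ℂ) →L[ℂ] ℂ} {C : ℝ} {N : ℕ} {R : ℝ}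
    (hT : ∀ j, IsLocalBound (T j) C N R) {S : 𝓢(V, ℂ) →L[ℂ] ℂ}
    (h : ∀ φ, Tendsto (fun j => T j φ) atTop (𝓝 (S φ))) : IsLocalBound S C N R :=
  fun φ B hB hφ => le_of_tendsto (h φ).norm (Eventually.of_forall fun j => hT j φ B hB hφ)

variable {T : 𝓢(V, ℂ) →L[ℂ] ℂ} {C : ℝ} {N : ℕ} {R : ℝ}

theorem IsLocalBound.norm_shift_le (hT : IsLocalBound T C N R) (hR : 0 ≤ R) (k : ℕ)
    (φ : 𝓢(V, ℂ)) (x : V) :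
    ‖x‖ ^ k * ‖T (shift x φ)‖ ≤ C * ((1 + R) ^ k *
      (2 ^ k * ((Finset.Iic (k, N)).sup fun m => SchwartzMap.seminorm ℝ m.1 m.2) φ)) := by
  set S := ((Finset.Iic (k, N)).sup fun m => SchwartzMap.seminorm ℝ m.1 m.2) φ
  have hS : 0 ≤ S := apply_nonneg _ _
  have hx : 0 < 1 + ‖x‖ := by positivity
  have h := hT (shift x φ) ((1 + R) ^ k * (2 ^ k * S) / (1 + ‖x‖) ^ k) (by positivity)
    (fun i hi y hy => by
      rw [iteratedFDeriv_shift, le_div_iff₀ (by positivity)]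
      have h1 : (1 + ‖x + y‖) ^ k * ‖iteratedFDeriv ℝ i φ (x + y)‖ ≤ 2 ^ k * S :=
        one_add_le_sup_seminorm_apply (𝕜 := ℝ) (m := (k, N)) le_rfl hi φ (x + y)
      -- Peetre's inequality: for `y` in the ball, decay in `x + y` is decay in `x`, at the price of
      -- `1 + R` per power.
      have h2 : 1 + ‖x‖ ≤ (1 + R) * (1 + ‖x + y‖) := by
        have : ‖x‖ ≤ ‖x + y‖ + ‖y‖ := by
          simpa using norm_sub_le (x + y) y
        nlinarith [norm_nonneg (x + y), mul_nonneg hR (norm_nonneg (x + y))]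
      calc ‖iteratedFDeriv ℝ i φ (x + y)‖ * (1 + ‖x‖) ^ k
          ≤ ‖iteratedFDeriv ℝ i φ (x + y)‖ * ((1 + R) * (1 + ‖x + y‖)) ^ k := by gcongr
        _ = (1 + R) ^ k * ((1 + ‖x + y‖) ^ k * ‖iteratedFDeriv ℝ i φ (x + y)‖) := by
            rw [mul_pow]; ring
        _ ≤ (1 + R) ^ k * (2 ^ k * S) := by gcongr)
  calc ‖x‖ ^ k * ‖T (shift x φ)‖ ≤ (1 + ‖x‖) ^ k *
        (C * ((1 + R) ^ k * (2 ^ k * S) / (1 + ‖x‖) ^ k)) := by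
        gcongr
        linarith
    _ = C * ((1 + R) ^ k * (2 ^ k * S)) := by field_simp

/-- The difference between increment and linear term is `T` applied to a Taylor remainder of `φ`.
All its derivatives up to order `N` are `O(‖h‖ ^ 2)` uniformly in `y`, so the local bound applies.
-/
theorem IsLocalBound.hasFDerivAt_shift (hT : IsLocalBound T C N R) (φ : 𝓢(V, ℂ))
    {L : V → V →L[ℝ] ℂ} (hL : ∀ x v, L x v = T (shift x (∂_{v} φ))) (x : V) :
    HasFDerivAt (fun x => T (shift x φ)) (L x) x := by
  set M := ((Finset.Iic (0, N + 2)).sup fun m => SchwartzMap.seminorm ℝ m.1 m.2) φ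
  have hM : 0 ≤ M := apply_nonneg _ _
  have hMi : ∀ i ≤ N, SchwartzMap.seminorm ℝ 0 (i + 2) φ ≤ M := fun i hi =>
    (Finset.le_sup (f := fun m : ℕ × ℕ => (SchwartzMap.seminorm ℝ m.1 m.2 : Seminorm ℝ 𝓢(V, ℂ)))
      (b := (0, i + 2)) (Finset.mem_Iic.2 (Prod.mk_le_mk.2 ⟨le_rfl, by omega⟩)) : _) φ
  rw [hasFDerivAt_iff_isLittleO_nhds_zero]
  refine Asymptotics.IsBigO.trans_isLittleO (g := fun h : V => ‖h‖ ^ 2) ?_ ?_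
  · refine Asymptotics.IsBigO.of_bound (C * M) (Eventually.of_forall fun h => ?_)
    rw [hL, ← map_sub, ← map_sub, norm_pow, norm_norm, mul_assoc]
    refine hT _ _ (by positivity) fun i hi y _ => ?_
    rw [iteratedFDeriv_sub_apply', iteratedFDeriv_sub_apply', iteratedFDeriv_shift,
      iteratedFDeriv_shift, iteratedFDeriv_shift, iteratedFDeriv_lineDerivOp, add_right_comm,
      pow_two, ← mul_assoc]
    refine norm_taylor_remainder_le (φ.hasFDerivAt_iteratedFDeriv i) (fun a b => ?_) (x + y) h
    refine (φ.norm_fderiv_iteratedFDeriv_sub_le i a b).trans ?_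
    gcongr
    exact hMi i hi
  · have h := (Asymptotics.isLittleO_norm_pow_id (E' := V) (n := 2) (by norm_num))
    exact h

end Local

section Conv

open LineDeriv

variable {n : ℕ} {T : 𝓢(Rn n, ℂ) →L[ℂ] ℂ} {C : ℝ} {N : ℕ} {R : ℝ}

/-- In coordinates the derivative is a finite combination of functions of the same kind, with `φ`
replaced by its partial derivatives. This drives the inductions on the order of differentiation. -/
theorem IsLocalBound.hasFDerivAt_shift_sum (hT : IsLocalBound T C N R) (φ : 𝓢(Rn n, ℂ)) (x : Rn n) :
    HasFDerivAt (fun x => T (shift x φ)) (∑ j, (EuclideanSpace.proj (𝕜 := ℝ) j).smulRight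
      (T (shift x (∂_{EuclideanSpace.basisFun (Fin n) ℝ j} φ)))) x := by
  refine hT.hasFDerivAt_shift φ (L := fun x => ∑ j, (EuclideanSpace.proj (𝕜 := ℝ) j).smulRight
      (T (shift x (∂_{EuclideanSpace.basisFun (Fin n) ℝ j} φ)))) (fun x v => ?_) x
  have hv : v = ∑ j, v j • EuclideanSpace.basisFun (Fin n) ℝ j := by
    simpa using ((EuclideanSpace.basisFun (Fin n) ℝ).sum_repr v).symm
  have h2 : (∂_{v} φ : 𝓢(Rn n, ℂ)) =
      ∑ j, ((v j : ℝ) : ℂ) • (∂_{EuclideanSpace.basisFun (Fin n) ℝ j} φ : 𝓢(Rn n, ℂ)) := by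
    conv_lhs => rw [hv]
    rw [lineDerivOp_left_sum]
    refine Finset.sum_congr rfl fun j _ => ?_
    rw [lineDerivOp_left_smul]
    ext y
    simp
  rw [h2, map_sum, map_sum, sum_apply]
  refine Finset.sum_congr rfl fun j _ => ?_
  rw [map_smul, map_smul]
  simp

theorem IsLocalBound.contDiff_shift (hT : IsLocalBound T C N R) (φ : 𝓢(Rn n, ℂ)) (k : ℕ) :
    ContDiff ℝ k (fun x => T (shift x φ)) := by
  induction k generalizing φ with
  | zero =>
    exact contDiff_zero.2 (continuous_iff_continuousAt.2 fun x =>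
      (hT.hasFDerivAt_shift_sum φ x).continuousAt)
  | succ k ih =>
    rw [Nat.cast_succ, contDiff_succ_iff_fderiv]
    refine ⟨fun x => (hT.hasFDerivAt_shift_sum φ x).differentiableAt, by simp, ?_⟩
    have : fderiv ℝ (fun x => T (shift x φ)) = fun x => ∑ j,
        (EuclideanSpace.proj (𝕜 := ℝ) j).smulRight
          (T (shift x (∂_{EuclideanSpace.basisFun (Fin n) ℝ j} φ))) :=
      funext fun x => (hT.hasFDerivAt_shift_sum φ x).fderiv
    rw [this]
    exact ContDiff.sum fun j _ =>
      (ContinuousLinearMap.smulRightL ℝ (Rn n) ℂ (EuclideanSpace.proj j)).contDiff.comp (ih _)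

/-- The Schwartz seminorms of `x ↦ T (φ (x + ·))` are controlled uniformly in `T`. -/
theorem exists_continuous_bound_shift (C : ℝ) (hR : 0 ≤ R) (N i k : ℕ) :
    ∃ q : 𝓢(Rn n, ℂ) → ℝ, Continuous q ∧ q 0 = 0 ∧ ∀ T, IsLocalBound T C N R → ∀ φ x,
      ‖x‖ ^ k * ‖iteratedFDeriv ℝ i (fun x => T (shift x φ)) x‖ ≤ q φ := by
  induction i with
  | zero =>
    refine ⟨fun φ => C * ((1 + R) ^ k *
      (2 ^ k * ((Finset.Iic (k, N)).sup (schwartzSeminormFamily ℝ (Rn n) ℂ)) φ)), ?_, by simp,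
      fun T hT φ x => ?_⟩
    · have : Continuous ((Finset.Iic (k, N)).sup (schwartzSeminormFamily ℝ (Rn n) ℂ) :
          Seminorm ℝ 𝓢(Rn n, ℂ)) :=
        (schwartz_withSeminorms ℝ (Rn n) ℂ).partial_sups.continuous_seminorm (k, N)
      fun_prop
    · rw [norm_iteratedFDeriv_zero]
      exact hT.norm_shift_le hR k φ x
  | succ i ih =>
    obtain ⟨q, hq, hq0, hb⟩ := ih
    let c : Fin n → ℝ := fun j =>
      ‖ContinuousLinearMap.smulRightL ℝ (Rn n) ℂ (EuclideanSpace.proj (𝕜 := ℝ) j)‖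
    let e := EuclideanSpace.basisFun (Fin n) ℝ
    refine ⟨fun φ => ∑ j, c j * q (∂_{e j} φ), ?_, ?_, fun T hT φ x => ?_⟩
    · exact continuous_finsetSum _ fun j _ =>
        (hq.comp (ContinuousLineDeriv.continuous_lineDerivOp (e j))).const_mul _
    · simp [lineDerivOp_zero, hq0]
    · rw [← norm_iteratedFDeriv_fderiv]
      have : fderiv ℝ (fun x => T (shift x φ)) = fun x => ∑ j,
          (ContinuousLinearMap.smulRightL ℝ (Rn n) ℂ (EuclideanSpace.proj (𝕜 := ℝ) j) ∘
            fun x => T (shift x (∂_{e j} φ))) x :=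
        funext fun x => (hT.hasFDerivAt_shift_sum φ x).fderiv
      rw [this, iteratedFDeriv_sum (fun j _ => (ContinuousLinearMap.contDiff _).comp
        (hT.contDiff_shift _ i)), Finset.sum_apply]
      calc ‖x‖ ^ k * ‖∑ j, iteratedFDeriv ℝ i
            (ContinuousLinearMap.smulRightL ℝ (Rn n) ℂ (EuclideanSpace.proj (𝕜 := ℝ) j) ∘
              fun x => T (shift x (∂_{e j} φ))) x‖
          ≤ ‖x‖ ^ k * ∑ j, c j * ‖iteratedFDeriv ℝ i (fun x => T (shift x (∂_{e j} φ))) x‖ := by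
            gcongr
            refine (norm_sum_le _ _).trans (Finset.sum_le_sum fun j _ => ?_)
            exact ContinuousLinearMap.norm_iteratedFDeriv_comp_left _
              (hT.contDiff_shift _ i).contDiffAt le_rfl
        _ = ∑ j, c j * (‖x‖ ^ k * ‖iteratedFDeriv ℝ i (fun x => T (shift x (∂_{e j} φ))) x‖) := by
            rw [Finset.mul_sum]
            exact Finset.sum_congr rfl fun j _ => by ring
        _ ≤ ∑ j, c j * q (∂_{e j} φ) := by
            gcongr with j
            exact hb T hT _ x

theorem IsLocalBound.exists_conv (hT : IsLocalBound T C N R) (hR : 0 ≤ R)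
    (φ : 𝓢(Rn n, ℂ)) : ∃ ζ : 𝓢(Rn n, ℂ), ∀ x, ζ x = T (shift x φ) :=
  ⟨{  toFun := fun x => T (shift x φ)
      smooth' := contDiff_infty.2 (hT.contDiff_shift φ)
      decay' := fun k i => by
        obtain ⟨q, -, -, hq⟩ := exists_continuous_bound_shift (n := n) C hR N i k
        exact ⟨q φ, hq T hT φ⟩ }, fun _ => rfl⟩

/-- Joint sequential continuity of the convolution of uniformly local functionals with Schwartz
functions. -/
theorem tendsto_conv {T : ℕ → 𝓢(Rn n, ℂ) →L[ℂ] ℂ} {S : 𝓢(Rn n, ℂ) →L[ℂ] ℂ} (hR : 0 ≤ R)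
    (hT : ∀ j, IsLocalBound (T j) C N R) (hTS : ∀ φ, Tendsto (fun j => T j φ) atTop (𝓝 (S φ)))
    {φ ζ : ℕ → 𝓢(Rn n, ℂ)} {ψ χ : 𝓢(Rn n, ℂ)} (hφ : Tendsto φ atTop (𝓝 ψ))
    (hζ : ∀ j x, ζ j x = T j (shift x (φ j))) (hχ : ∀ x, χ x = S (shift x ψ)) :
    Tendsto ζ atTop (𝓝 χ) := by
  -- By the Montel argument it suffices to have bounded seminorms, from continuity of `q` along `φ`,
  -- and pointwise limits, from splitting `φ j = (φ j - ψ) + ψ`.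
  refine tendsto_of_tendsto_apply (fun k i => ?_) fun x => ?_
  · obtain ⟨q, hq, -, hb⟩ := exists_continuous_bound_shift (n := n) C hR N i k
    obtain ⟨M, hM⟩ := ((hq.tendsto ψ).comp hφ).bddAbove_range
    refine ⟨M, fun j => ?_⟩
    have hjM : q (φ j) ≤ M := hM (Set.mem_range_self j)
    refine seminorm_le_bound ℝ k i _ ?_ fun x => ?_
    · refine le_trans ?_ ((hb (T j) (hT j) (φ j) 0).trans hjM)
      positivity
    · have : ⇑(ζ j) = fun x => T j (shift x (φ j)) := funext (hζ j)
      rw [this]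
      exact (hb (T j) (hT j) (φ j) x).trans hjM
  · obtain ⟨q, hq, hq0, hb⟩ := exists_continuous_bound_shift (n := n) C hR N 0 0
    have h1 : Tendsto (fun j => T j (shift x (φ j - ψ))) atTop (𝓝 0) := by
      refine squeeze_zero_norm (a := fun j => q (φ j - ψ)) (fun j => ?_) ?_
      · simpa using hb (T j) (hT j) (φ j - ψ) x
      · rw [← hq0]
        refine (hq.tendsto 0).comp ?_
        simpa using hφ.sub_const ψ
    rw [hχ]
    have h2 := h1.add (hTS (shift x ψ))
    simp only [map_sub, sub_add_cancel, zero_add] at h2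
    simpa only [hζ] using h2

end Conv

end SchwartzMap

/-! ### Baire category for demi-linear maps -/

namespace DemiDist

section DemiLinear

variable {X : Type*} [AddCommGroup X] [Module ℂ X]

theorem norm_apply_add_le {γ : ℂ → ℂ} {U : Set X} {g : X → ℂ} (hg : g ∈ demiLinear γ U) (x : X)
    {u : X} (hu : u ∈ U) : ‖g (x + u)‖ ≤ (1 + ‖γ 1‖) * ‖g x‖ + ‖γ 1‖ * ‖g u‖ := by
  obtain ⟨r, s, hr, hs, h⟩ := hg.2 x u hu 1 (by simp)
  rw [one_smul] at h
  rw [h]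
  refine (norm_add_le _ _).trans ?_
  rw [smul_eq_mul, smul_eq_mul, norm_mul, norm_mul]
  have : ‖r‖ ≤ 1 + ‖γ 1‖ := by
    have := norm_add_le (r - 1) 1
    simp only [sub_add_cancel, norm_one] at this
    linarith
  gcongr

variable [TopologicalSpace X]

/-- Used to pull demi-distributions back to a Fréchet subspace, where the Baire argument is
available even if the ambient space is not Baire. -/
theorem demiDistributions.comp {Y : Type*} [AddCommGroup Y] [Module ℂ Y] [TopologicalSpace Y]
    {γ : ℂ → ℂ} {U : Set X} {g : X → ℂ} (hg : g ∈ demiDistributions γ U) (L : Y →L[ℂ] X) :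
    g ∘ L ∈ demiDistributions γ (L ⁻¹' U) := by
  obtain ⟨hc, h0, h⟩ := hg
  refine ⟨hc.comp L.continuous, by simp [h0], fun x u hu t ht => ?_⟩
  simpa using h (L x) (L u) hu t ht

variable [IsTopologicalAddGroup X] [ContinuousSMul ℂ X] [BaireSpace X]

/-- A pointwise bounded family of demi-distributions on a Baire space is bounded on a neighbourhood
of the origin. -/
theorem exists_nhds_zero_norm_le {ι : Type*} {γ : ℂ → ℂ} {U : Set X} (hU : U ∈ 𝓝 (0 : X))
    {g : ι → X → ℂ} (hg : ∀ m, g m ∈ demiDistributions γ U) (hb : ∀ x, ∃ C, ∀ m, ‖g m x‖ ≤ C) :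
    ∃ W ∈ 𝓝 (0 : X), ∃ M, ∀ w ∈ W, ∀ m, ‖g m w‖ ≤ M := by
  let A : ℕ → Set X := fun N => {x | ∀ m, ‖g m x‖ ≤ N}
  have hA : ∀ N, IsClosed (A N) := fun N => by
    simp only [A, Set.ofPred_forall]
    exact isClosed_iInter fun m => isClosed_le (hg m).1.norm continuous_const
  obtain ⟨N, x₀, hx₀⟩ := nonempty_interior_of_iUnion_of_closed hA (by
    refine Set.eq_univ_of_forall fun x => ?_
    obtain ⟨C, hC⟩ := hb x
    obtain ⟨N, hN⟩ := exists_nat_ge C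
    exact Set.mem_iUnion.2 ⟨N, fun m => (hC m).trans hN⟩)
  -- Demi-linearity controls only the addition of elements of `U`, and `-x₀` need not lie there. So
  -- `x₀ + w` is moved to `w` in `p + 1` small steps, each keeping the family bounded.
  obtain ⟨p, hp⟩ : ∃ p : ℕ, (-((p : ℂ) + 1)⁻¹) • x₀ ∈ U := by
    have h1 : Tendsto (fun p : ℕ => (-((p : ℂ) + 1)⁻¹) • x₀) atTop (𝓝 0) := by
      have h2 : Tendsto (fun p : ℕ => ((p : ℂ) + 1)⁻¹) atTop (𝓝 0) := by
        simpa [one_div] using tendsto_one_div_add_atTop_nhds_zero_nat (𝕜 := ℂ)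
      simpa using h2.neg.smul_const x₀
    exact (h1.eventually hU).exists
  set u := (-((p : ℂ) + 1)⁻¹) • x₀ with hu
  obtain ⟨Cu, hCu⟩ := hb u
  have step : ∀ j : ℕ, ∀ B : ℝ, ∃ M, ∀ m x, ‖g m x‖ ≤ B → ‖g m (x + j • u)‖ ≤ M := by
    intro j
    induction j with
    | zero => exact fun B => ⟨B, fun m x hx => by simpa using hx⟩
    | succ j ih =>
      intro B
      obtain ⟨M, hM⟩ := ih B
      refine ⟨(1 + ‖γ 1‖) * M + ‖γ 1‖ * Cu, fun m x hx => ?_⟩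
      rw [succ_nsmul, ← add_assoc]
      refine (norm_apply_add_le (hg m).2 _ hp).trans ?_
      have := hM m x hx
      have := hCu m
      gcongr
  obtain ⟨M, hM⟩ := step (p + 1) N
  refine ⟨(fun w => x₀ + w) ⁻¹' interior (A N), ?_, M, fun w hw m => ?_⟩
  · refine (continuous_const.add continuous_id).continuousAt.preimage_mem_nhds ?_
    simpa using isOpen_interior.mem_nhds hx₀
  · have h1 := hM m (x₀ + w) (interior_subset hw m)
    have h2 : x₀ + w + (p + 1) • u = w := by
      have hp1 : (p : ℂ) + 1 ≠ 0 := by exact_mod_cast Nat.succ_ne_zero p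
      have : (p + 1) • u = -x₀ := by
        rw [hu, ← Nat.cast_smul_eq_nsmul ℂ, smul_smul]
        push_cast
        rw [mul_neg, mul_inv_cancel₀ hp1, neg_one_smul]
      rw [this]
      abel
    rwa [h2] at h1

/-- **Banach-Steinhaus** for demi-distributions: a pointwise bounded family on a Baire space is
equicontinuous. -/
theorem eventually_norm_sub_lt {ι : Type*} {γ : ℂ → ℂ} (hγ : γ ∈ C0) {U : Set X}
    (hU : U ∈ 𝓝 (0 : X)) {g : ι → X → ℂ} (hg : ∀ m, g m ∈ demiDistributions γ U)
    (hb : ∀ x, ∃ C, ∀ m, ‖g m x‖ ≤ C) (x : X) {ε : ℝ} (hε : 0 < ε) :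
    ∀ᶠ y in 𝓝 x, ∀ m, ‖g m y - g m x‖ < ε := by
  obtain ⟨W, hW, M, hM⟩ := exists_nhds_zero_norm_le hU hg hb
  obtain ⟨C, hC⟩ := hb x
  -- Writing `y = x + t • (t⁻¹ • (y - x))` gives an increment with coefficients `r - 1` and `s`,
  -- both bounded by `‖γ t‖`. Once `t` is fixed, the rescaled point lies in `W ∩ U` for `y` near
  -- `x`.
  obtain ⟨t, ht0, ht1, ht⟩ : ∃ t : ℂ, t ≠ 0 ∧ ‖t‖ ≤ 1 ∧ ‖γ t‖ * (|C| + |M|) < ε := by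
    have h1 : ∀ᶠ t in 𝓝 (0 : ℂ), ‖γ t‖ * (|C| + |M|) < ε := by
      have : Tendsto (fun t => ‖γ t‖ * (|C| + |M|)) (𝓝 0) (𝓝 0) := by
        simpa using hγ.2.1.norm.mul_const (|C| + |M|)
      exact this.eventually (gt_mem_nhds hε)
    have h2 : ∀ᶠ t in 𝓝 (0 : ℂ), ‖t‖ ≤ 1 :=
      mem_of_superset (Metric.closedBall_mem_nhds (0 : ℂ) one_pos) fun t ht => by simpa using ht
    have h3 := ((h1.and h2).filter_mono nhdsWithin_le_nhds).and
      (self_mem_nhdsWithin : {(0 : ℂ)}ᶜ ∈ 𝓝[≠] 0)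
    obtain ⟨t, ⟨ha, hb⟩, hc⟩ := h3.exists
    exact ⟨t, hc, hb, ha⟩
  have hcont : Tendsto (fun y => t⁻¹ • (y - x)) (𝓝 x) (𝓝 0) := by
    have : Continuous fun y => t⁻¹ • (y - x) := by fun_prop
    simpa using this.tendsto x
  filter_upwards [hcont.eventually (inter_mem hW hU)] with y hy m
  obtain ⟨r, s, hr, hs, h⟩ := (hg m).2.2 x _ hy.2 t ht1
  rw [smul_smul, mul_inv_cancel₀ ht0, one_smul, add_sub_cancel] at h
  have e : g m y - g m x = (r - 1) * g m x + s * g m (t⁻¹ • (y - x)) := by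
    rw [h, smul_eq_mul, smul_eq_mul]
    ring
  rw [e]
  refine lt_of_le_of_lt ((norm_add_le _ _).trans ?_) ht
  rw [norm_mul, norm_mul, mul_add]
  have h1 := (hC m).trans (le_abs_self C)
  have h2 := (hM _ hy.1 m).trans (le_abs_self M)
  gcongr

/-- Joint sequential continuity of pointwise convergent sequences of demi-distributions. -/
theorem tendsto_apply_of_tendsto {γ : ℂ → ℂ} (hγ : γ ∈ C0) {U : Set X}
    (hU : U ∈ 𝓝 (0 : X)) {gk : ℕ → X → ℂ} {g : X → ℂ} (hg : ∀ m, gk m ∈ demiDistributions γ U)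
    (hlim : ∀ x, Tendsto (fun m => gk m x) atTop (𝓝 (g x))) {m : ℕ → ℕ}
    (hm : Tendsto m atTop atTop) {y : ℕ → X} {x : X} (hy : Tendsto y atTop (𝓝 x)) :
    Tendsto (fun j => gk (m j) (y j)) atTop (𝓝 (g x)) := by
  have hb : ∀ x, ∃ C, ∀ m, ‖gk m x‖ ≤ C := fun x => by
    obtain ⟨C, hC⟩ := (hlim x).norm.bddAbove_range
    exact ⟨C, fun m => hC (Set.mem_range_self m)⟩
  have h1 : Tendsto (fun j => gk (m j) (y j) - gk (m j) x) atTop (𝓝 0) := by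
    rw [Metric.tendsto_nhds]
    intro ε hε
    filter_upwards [hy.eventually (eventually_norm_sub_lt hγ hU hg hb x hε)] with j hj
    simpa using hj (m j)
  simpa using h1.add ((hlim x).comp hm)

end DemiLinear

end DemiDist

/-! ### From a seminorm bound and a cutoff to a local bound -/

namespace SchwartzMap

variable {V : Type*} [NormedAddCommGroup V] [NormedSpace ℝ V]

theorem norm_iteratedFDeriv_mul_le_two_pow {g : V → ℂ} (hg : ContDiff ℝ (⊤ : ℕ∞) g)
    (φ : 𝓢(V, ℂ)) (i : ℕ) (y : V) {A B : ℝ} (hA : ∀ j ≤ i, ‖iteratedFDeriv ℝ j g y‖ ≤ A)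
    (hB : ∀ j ≤ i, ‖iteratedFDeriv ℝ j φ y‖ ≤ B) :
    ‖iteratedFDeriv ℝ i (fun x => g x * φ x) y‖ ≤ 2 ^ i * A * B := by
  have hA0 : 0 ≤ A := (norm_nonneg _).trans (hA 0 (Nat.zero_le _))
  refine (norm_iteratedFDeriv_mul_le hg (φ.smooth ⊤) y (n := i)
    (by exact_mod_cast le_top)).trans ?_
  calc ∑ j ∈ Finset.range (i + 1), (i.choose j : ℝ) * ‖iteratedFDeriv ℝ j g y‖ *
        ‖iteratedFDeriv ℝ (i - j) φ y‖
      ≤ ∑ j ∈ Finset.range (i + 1), (i.choose j : ℝ) * A * B := by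
        refine Finset.sum_le_sum fun j hj => ?_
        have := hA j (Nat.lt_succ_iff.1 (Finset.mem_range.1 hj))
        have := hB (i - j) (Nat.sub_le _ _)
        gcongr
    _ = 2 ^ i * A * B := by
        rw [← Finset.sum_mul, ← Finset.sum_mul, ← Nat.cast_sum, Nat.sum_range_choose]
        simp

/-- A functional that is invariant under multiplication by a cutoff function satisfies local
bounds, uniformly over families bounded by a fixed continuous seminorm. -/
theorem exists_isLocalBound {ι : Type*} {T : ι → 𝓢(V, ℂ) →L[ℂ] ℂ} {q : Seminorm ℂ 𝓢(V, ℂ)}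
    (hq : Continuous q) (hTq : ∀ j φ, ‖T j φ‖ ≤ q φ) {χ : 𝓢(V, ℂ)} {R : ℝ} (hR : 0 ≤ R)
    (hχ : tsupport χ ⊆ Metric.closedBall 0 R)
    (hTχ : ∀ j φ, T j (smulLeftCLM ℂ χ φ) = T j φ) :
    ∃ C N, ∀ j, IsLocalBound (T j) C N R := by
  obtain ⟨s, C, -, hC⟩ := Seminorm.bound_of_continuous (schwartz_withSeminorms ℂ V ℂ) q hq
  let D : ℕ → ℝ := fun i => ∑ j ∈ Finset.range (i + 1), SchwartzMap.seminorm ℝ 0 j χ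
  have hD : ∀ i, 0 ≤ D i := fun i => Finset.sum_nonneg fun j _ => apply_nonneg _ _
  have hχD : ∀ i, ∀ j ≤ i, ∀ y, ‖iteratedFDeriv ℝ j χ y‖ ≤ D i := fun i j hj y =>
    (χ.norm_iteratedFDeriv_le_seminorm ℝ j y).trans
      (Finset.single_le_sum (f := fun j => SchwartzMap.seminorm ℝ 0 j χ)
        (fun j _ => apply_nonneg _ _) (Finset.mem_range.2 (Nat.lt_succ_iff.2 hj)))
  let A : ℕ × ℕ → ℝ := fun m => R ^ m.1 * (2 ^ m.2 * D m.2)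
  have hA : ∀ m, 0 ≤ A m := fun m => by have := hD m.2; positivity
  -- The order `N` is the highest derivative among the finitely many seminorms dominating `q`. Each
  -- weight `A m` collects the polynomial factor on the ball and the Leibniz constants of `χ`.
  refine ⟨C * ∑ m ∈ s, A m, s.sup Prod.snd, fun j φ B hB hφ => ?_⟩
  rw [← hTχ j φ, mul_assoc]
  refine (hTq j _).trans ((hC _).trans ?_)
  rw [smul_apply, NNReal.smul_def, smul_eq_mul]
  gcongr
  refine Seminorm.finset_sup_apply_le (mul_nonneg (Finset.sum_nonneg fun m _ => hA m) hB)
    fun m hm => ?_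
  refine le_trans ?_ (mul_le_mul_of_nonneg_right
    (Finset.single_le_sum (fun m _ => hA m) hm) hB)
  refine seminorm_le_bound ℂ m.1 m.2 _ (mul_nonneg (hA m) hB) fun y => ?_
  by_cases hy : ‖y‖ ≤ R
  · have hmN : m.2 ≤ s.sup Prod.snd := Finset.le_sup (f := Prod.snd) hm
    have h1 := norm_iteratedFDeriv_mul_le_two_pow (χ.smooth ⊤) φ m.2 y
      (fun j hj => hχD m.2 j hj y) (fun j hj => hφ j (hj.trans hmN) y hy)
    have e : ⇑(smulLeftCLM ℂ χ φ) = fun x => χ x * φ x := by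
      rw [smulLeftCLM_apply χ.hasTemperateGrowth]
      rfl
    rw [e]
    calc ‖y‖ ^ m.1 * ‖iteratedFDeriv ℝ m.2 (fun x => χ x * φ x) y‖
        ≤ R ^ m.1 * (2 ^ m.2 * D m.2 * B) := by gcongr
      _ = A m * B := by simp only [A]; ring
  · have hz : iteratedFDeriv ℝ m.2 (smulLeftCLM ℂ χ φ) y = 0 := by
      by_contra hne
      have h1 := support_iteratedFDeriv_subset m.2 hne
      have h2 := hχ ((tsupport_smulLeftCLM_subset (F := ℂ) χ φ).trans Set.inter_subset_right h1)
      exact hy (by simpa using h2)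
    rw [hz, norm_zero, mul_zero]
    exact mul_nonneg (hA m) hB

end SchwartzMap

/-! ### Test function spaces modelled on the Schwartz space -/

namespace DemiDist

open SchwartzMap

variable {n : ℕ}

theorem baireSpace_of_isClosed {P : Submodule ℂ (SpaceS n)} (hP : IsClosed (P : Set (SpaceS n))) :
    BaireSpace P := by
  have : (uniformity (SpaceS n)).IsCountablyGenerated :=
    IsUniformAddGroup.uniformity_countably_generated
  have : IsCompletelyPseudoMetrizableSpace P := hP.isCompletelyPseudoMetrizableSpace
  infer_instance

instance instBaireSpace : BaireSpace (SpaceS n) := by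
  have : (uniformity (SpaceS n)).IsCountablyGenerated :=
    IsUniformAddGroup.uniformity_countably_generated
  infer_instance

/-- The Schwartz functions that vanish on `Z`. -/
def vanishingOn (Z : Set (Rn n)) : Submodule ℂ (SpaceS n) where
  carrier := {φ | ∀ x ∈ Z, φ x = 0}
  add_mem' {φ ψ} hφ hψ x hx := by simp [hφ x hx, hψ x hx]
  zero_mem' x _ := rfl
  smul_mem' c φ hφ x hx := by simp [hφ x hx]

theorem mem_vanishingOn {Z : Set (Rn n)} {φ : SpaceS n} :
    φ ∈ vanishingOn Z ↔ ∀ x ∈ Z, φ x = 0 := Iff.rfl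

theorem isClosed_vanishingOn (Z : Set (Rn n)) : IsClosed (vanishingOn Z : Set (SpaceS n)) := by
  have : (vanishingOn Z : Set (SpaceS n)) = ⋂ x ∈ Z, {φ | evalPointCLM x φ = 0} := by
    ext φ
    simp [mem_vanishingOn, evalPointCLM_apply]
  rw [this]
  exact isClosed_biInter fun x _ => isClosed_eq (evalPointCLM x).continuous continuous_const

/-- A space `E` of test functions on `ℝⁿ` that is the union of the closed subspaces of the Schwartz
space formed by the functions vanishing on the sets `zeros r`, in such a way that bounded subsets
of `E` are contained in one of these. -/
structure SchwartzModel (n : ℕ) (E : Type) [FunLike E (Rn n) ℂ] [AddCommGroup E] [Module ℂ E]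
    [TopologicalSpace E] where
  toS : E →L[ℂ] SpaceS n
  toS_apply : ∀ ξ x, toS ξ x = ξ x
  zeros : ℝ → Set (Rn n)
  lt_norm : ∀ r, ∀ x ∈ zeros r, r < ‖x‖
  add_mem_zeros : ∀ r R, ∀ x ∈ zeros (r + R), ∀ y, ‖y‖ ≤ R → x + y ∈ zeros r
  ofS : ∀ r, vanishingOn (zeros r) →L[ℂ] E
  ofS_apply : ∀ r φ x, ofS r φ x = (φ : SpaceS n) x
  exists_zeros : ∀ B : Set E,
    (∀ L : E →L[ℂ] BoundedContinuousFunction ℕ ℂ, Bornology.IsBounded (L '' B)) →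
      ∃ r, ∀ ξ ∈ B, ∀ x ∈ zeros r, ξ x = 0
  exists_eq : ∀ θ : Rn n → ℂ, ContDiff ℝ (⊤ : ℕ∞) θ → HasCompactSupport θ → ∃ ξ : E, ⇑ξ = θ
  exists_approx : ∀ ζ : E, ∃ ζk : ℕ → E, (∀ j, HasCompactSupport (ζk j)) ∧
    (∀ j, tsupport (ζk j) ⊆ tsupport ζ) ∧ Tendsto ζk atTop (𝓝 ζ)

namespace SchwartzModel

variable {E : Type} [FunLike E (Rn n) ℂ] [AddCommGroup E] [Module ℂ E] [TopologicalSpace E]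
  (M : SchwartzModel n E)

theorem toS_injective : Function.Injective M.toS := fun ξ η h => by
  refine DFunLike.ext _ _ fun x => ?_
  rw [← M.toS_apply, ← M.toS_apply, h]

theorem toS_ofS (r : ℝ) (φ : vanishingOn (M.zeros r)) : M.toS (M.ofS r φ) = φ := by
  ext x
  rw [M.toS_apply, M.ofS_apply]

theorem exists_ofS_eq {r : ℝ} {ξ : E} (h : ∀ x ∈ M.zeros r, ξ x = 0) :
    ∃ φ : vanishingOn (M.zeros r), (φ : SpaceS n) = M.toS ξ ∧ M.ofS r φ = ξ := by
  refine ⟨⟨M.toS ξ, fun x hx => by rw [M.toS_apply, h x hx]⟩, rfl, M.toS_injective ?_⟩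
  rw [toS_ofS]

/-- Continuous linear images of a convergent sequence are bounded. Phrasing `exists_zeros` through
such images lets it serve convergent sequences and von Neumann bounded sets alike, with no further
assumption on the topology of `E`. -/
theorem exists_zeros_of_tendsto {ξk : ℕ → E} {ξ : E} (h : Tendsto ξk atTop (𝓝 ξ)) :
    ∃ r, (∀ x ∈ M.zeros r, ξ x = 0) ∧ ∀ j, ∀ x ∈ M.zeros r, ξk j x = 0 := by
  obtain ⟨r, hr⟩ := M.exists_zeros (insert ξ (Set.range ξk)) fun L => by
    rw [Set.image_insert_eq, ← Set.range_comp, Bornology.isBounded_insert]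
    exact Metric.isBounded_range_of_tendsto _ ((L.continuous.tendsto ξ).comp h)
  exact ⟨r, hr ξ (Set.mem_insert _ _), fun j => hr _ (Set.mem_insert_of_mem _ ⟨j, rfl⟩)⟩

theorem exists_zeros_apply (ξ : E) : ∃ r, ∀ x ∈ M.zeros r, ξ x = 0 :=
  (M.exists_zeros_of_tendsto (tendsto_const_nhds (x := ξ))).imp fun _ h => h.1

section Support

/-- Finitely many open sets on which `f` vanishes cover the compact support, and a subordinate
smooth partition of unity splits `ζ` into pieces killed by `f`. -/
theorem apply_eq_zero_of_hasCompactSupport (M : SchwartzModel n E) (f : E →L[ℂ] ℂ) {ζ : E} (hζ : HasCompactSupport ζ)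
    (h : tsupport ζ ⊆ (Distribution.dsupport f)ᶜ) : f ζ = 0 := by
  have hU : ∀ x ∈ tsupport ζ, ∃ a : Set (Rn n), Distribution.IsVanishingOn f a ∧ IsOpen a ∧
      x ∈ a := fun x hx => (Distribution.notMem_dsupport_iff x).1 (h hx)
  choose! a ha hao hax using hU
  obtain ⟨t, htK, ht⟩ := hζ.isCompact.elim_nhds_subcover a fun x hx =>
    (hao x hx).mem_nhds (hax x hx)
  obtain ⟨ρ, hρ⟩ := SmoothPartitionOfUnity.exists_isSubordinate (modelWithCornersSelf ℝ (Rn n))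
    (isClosed_tsupport ζ) (fun i : t => a i) (fun i => hao i (htK i i.2)) (by
      simpa [Set.iUnion_subtype] using ht)
  have hsm : ContDiff ℝ (⊤ : ℕ∞) ζ := by
    have := (M.toS ζ).smooth ⊤
    rwa [show ⇑(M.toS ζ) = ζ from funext (M.toS_apply ζ)] at this
  have hθ : ∀ i : t, ∃ ξ : E, ⇑ξ = fun x => ((ρ i x : ℝ) : ℂ) * ζ x := fun i =>
    M.exists_eq _ ((Complex.ofRealCLM.contDiff.comp (ρ i).contMDiff.contDiff).mul hsm)
      hζ.mul_left
  choose ξ hξ using hθ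
  have hsum : ζ = ∑ i, ξ i := by
    refine M.toS_injective ?_
    rw [map_sum]
    ext x
    rw [M.toS_apply, ← evalPointCLM_apply x, map_sum]
    simp only [evalPointCLM_apply, M.toS_apply, hξ]
    rw [← Finset.sum_mul, ← Complex.ofReal_sum]
    by_cases hx : x ∈ tsupport ζ
    · have h1 := ρ.sum_eq_one hx
      rw [finsum_eq_sum_of_fintype] at h1
      rw [h1, Complex.ofReal_one, one_mul]
    · rw [image_eq_zero_of_notMem_tsupport hx, mul_zero]
  rw [hsum, map_sum]
  refine Finset.sum_eq_zero fun i _ => ha i (htK i i.2) _ ?_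
  rw [hξ]
  refine (tsupport_mul_subset_left (f := fun x => ((ρ i x : ℝ) : ℂ))).trans
    (Set.Subset.trans ?_ (hρ i))
  exact tsupport_comp_subset (g := ((↑) : ℝ → ℂ)) Complex.ofReal_zero (ρ i)

/-- A distribution vanishes on the test functions supported off its support. -/
theorem apply_eq_zero (M : SchwartzModel n E) (f : E →L[ℂ] ℂ) {ζ : E}
    (h : tsupport ζ ⊆ (Distribution.dsupport f)ᶜ) : f ζ = 0 := by
  obtain ⟨ζk, hc, hs, hlim⟩ := M.exists_approx ζ
  refine tendsto_nhds_unique ((f.continuous.tendsto ζ).comp hlim) ?_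
  refine tendsto_const_nhds.congr fun j => ?_
  exact (M.apply_eq_zero_of_hasCompactSupport f (hc j) ((hs j).trans h)).symm

end Support

/-- A smooth cutoff function as a Schwartz function. -/
theorem exists_cutoff {r : ℝ} (hr : 0 < r) : ∃ χ : SpaceS n, (∀ x, ‖x‖ ≤ r → χ x = 1) ∧
    tsupport χ ⊆ Metric.closedBall 0 (r + 1) := by
  let b : ContDiffBump (0 : Rn n) := ⟨r, r + 1, hr, by linarith⟩
  have hc : HasCompactSupport fun x => ((b x : ℝ) : ℂ) :=
    b.hasCompactSupport.comp_left (g := ((↑) : ℝ → ℂ)) Complex.ofReal_zero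
  refine ⟨hc.toSchwartzMap (Complex.ofRealCLM.contDiff.comp b.contDiff), fun x hx => ?_, ?_⟩
  · have : b x = 1 := b.one_of_mem_closedBall (by simpa using hx)
    change ((b x : ℝ) : ℂ) = 1
    rw [this, Complex.ofReal_one]
  · have : tsupport (fun x => ((b x : ℝ) : ℂ)) ⊆ tsupport b :=
      tsupport_comp_subset (g := ((↑) : ℝ → ℂ)) Complex.ofReal_zero b
    refine this.trans ?_
    rw [b.tsupport_eq]

/-- Pointwise convergent sequences of functionals with supports in a common bounded set come from
sequences of tempered functionals with uniform local bounds. -/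
theorem exists_isLocalBound {fk : ℕ → E →L[ℂ] ℂ} {f : E → ℂ}
    (hf : ∀ ξ, Tendsto (fun k => fk k ξ) atTop (𝓝 (f ξ))) {F : Set (Rn n)}
    (hF : Bornology.IsBounded F) (hFk : ∀ k, Distribution.dsupport (fk k) ⊆ F) :
    ∃ (T : ℕ → SpaceS n →L[ℂ] ℂ) (S : SpaceS n →L[ℂ] ℂ) (C : ℝ) (N : ℕ) (R : ℝ), 0 ≤ R ∧
      (∀ k, IsLocalBound (T k) C N R) ∧ IsLocalBound S C N R ∧
      (∀ φ, Tendsto (fun k => T k φ) atTop (𝓝 (S φ))) ∧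
      (∀ k ξ, fk k ξ = T k (M.toS ξ)) ∧ ∀ ξ, f ξ = S (M.toS ξ) := by
  obtain ⟨r, hr0, hFr⟩ := hF.subset_closedBall_lt 0 0
  -- `χ` is 1 on a ball strictly larger than that containing `F`, so the closed support of `ξ - χ ξ`
  -- misses `F`. `χ'` is 1 on the support of `χ`, so `P` absorbs it.
  obtain ⟨χ, hχ1, hχs⟩ := exists_cutoff (n := n) (r := r + 1) (by linarith)
  obtain ⟨χ', hχ'1, hχ's⟩ := exists_cutoff (n := n) (r := r + 1 + 1) (by linarith)
  have mul_apply : ∀ (χ φ : SpaceS n) x, smulLeftCLM ℂ χ φ x = χ x * φ x := fun χ φ x => by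
    rw [smulLeftCLM_apply_apply χ.hasTemperateGrowth, smul_eq_mul]
  have hmem : ∀ φ, smulLeftCLM ℂ χ φ ∈ vanishingOn (M.zeros (r + 1 + 1)) := fun φ x hx => by
    rw [mul_apply]
    have : χ x = 0 := image_eq_zero_of_notMem_tsupport fun h => by
      have h1 := hχs h
      have h2 := M.lt_norm _ x hx
      rw [mem_closedBall_zero_iff] at h1
      linarith
    rw [this, zero_mul]
  let P : SpaceS n →L[ℂ] E := (M.ofS (r + 1 + 1)).comp
    ((smulLeftCLM ℂ χ).codRestrict (vanishingOn (M.zeros (r + 1 + 1))) hmem)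
  have hP : ∀ φ x, P φ x = χ x * φ x := fun φ x => by
    rw [← mul_apply]
    exact M.ofS_apply _ _ x
  have hPχ' : ∀ φ, P (smulLeftCLM ℂ χ' φ) = P φ := fun φ => DFunLike.ext _ _ fun x => by
    rw [hP, hP, mul_apply]
    by_cases hx : ‖x‖ ≤ r + 1 + 1
    · rw [hχ'1 x hx, one_mul]
    · have : χ x = 0 := image_eq_zero_of_notMem_tsupport fun h => hx (by simpa using hχs h)
      rw [this, zero_mul, zero_mul]
  have hfP : ∀ k ξ, fk k ξ = fk k (P (M.toS ξ)) := fun k ξ => by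
    rw [← sub_eq_zero, ← map_sub]
    refine M.apply_eq_zero (fk k) ?_
    have hz : ∀ x, ‖x‖ ≤ r + 1 → (ξ - P (M.toS ξ)) x = 0 := fun x hx => by
      rw [← M.toS_apply, map_sub, sub_apply, M.toS_apply, M.toS_apply, hP, M.toS_apply,
        hχ1 x hx, one_mul, sub_self]
    have hsub : tsupport (ξ - P (M.toS ξ)) ⊆ {x | r + 1 ≤ ‖x‖} := by
      refine closure_minimal (fun x hx => ?_) (isClosed_le continuous_const continuous_norm)
      by_contra hlt
      exact hx (hz x (not_le.1 hlt).le)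
    intro x hx hxs
    have h1 := hFr (hFk k hxs)
    have h2 := hsub hx
    rw [mem_closedBall_zero_iff] at h1
    simp only [Set.mem_ofPred_eq] at h2
    linarith
  let T : ℕ → SpaceS n →L[ℂ] ℂ := fun k => (fk k).comp P
  have hT : Tendsto (fun k φ => T k φ) atTop (𝓝 fun φ => f (P φ)) :=
    tendsto_pi_nhds.2 fun φ => hf (P φ)
  -- Banach-Steinhaus is applied on the Schwartz space, not on `E`.
  let S : SpaceS n →L[ℂ] ℂ := continuousLinearMapOfTendsto T hT
  have hTS : ∀ φ, Tendsto (fun k => T k φ) atTop (𝓝 (S φ)) := fun φ => hf (P φ)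
  have heq : UniformEquicontinuous ((↑) ∘ T : ℕ → SpaceS n → ℂ) :=
    (norm_withSeminorms ℂ ℂ).banach_steinhaus fun _ φ => (hTS φ).norm.bddAbove_range
  obtain ⟨q, hq, hTq⟩ := ((norm_withSeminorms ℂ ℂ).uniformEquicontinuous_iff_exists_continuous_seminorm
    (fun k => (T k : SpaceS n →ₗ[ℂ] ℂ))).1 heq 0
  have hr3 : (0 : ℝ) ≤ r + 1 + 1 + 1 := by linarith
  obtain ⟨C, N, hCN⟩ := SchwartzMap.exists_isLocalBound hq (fun j φ => hTq j φ) hr3 hχ's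
    (fun j φ => congrArg (fk j) (hPχ' φ))
  exact ⟨T, S, C, N, _, hr3, hCN, IsLocalBound.of_tendsto hCN hTS, hTS, hfP,
    fun ξ => tendsto_nhds_unique (hf ξ) ((hTS (M.toS ξ)).congr fun k => (hfP k ξ).symm)⟩

/-- Bounded sequences have convergent subsequences. -/
theorem exists_subseq_tendsto (M : SchwartzModel n E) {B : Set E} (hB : Bornology.IsVonNBounded ℂ B) {ξ : ℕ → E}
    (hξ : ∀ j, ξ j ∈ B) : ∃ η, ∃ σ : ℕ → ℕ, StrictMono σ ∧ Tendsto (ξ ∘ σ) atTop (𝓝 η) := by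
  obtain ⟨r, hr⟩ := M.exists_zeros B fun L =>
    (NormedSpace.isVonNBounded_iff ℂ).1 (hB.image L)
  have hS := (schwartz_withSeminorms ℂ (Rn n) ℂ).isVonNBounded_iff_seminorm_bounded.1
    (hB.image M.toS)
  obtain ⟨ψ, σ, hσ, hψ⟩ := SchwartzMap.exists_subseq_tendsto (φ := fun j => M.toS (ξ j))
    fun k i => by
      obtain ⟨C, -, hC⟩ := hS (k, i)
      exact ⟨C, fun j => (hC _ (Set.mem_image_of_mem _ (hξ j))).le⟩
  choose φ hφ hφ' using fun j => M.exists_ofS_eq (hr _ (hξ j))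
  have hmem : ψ ∈ vanishingOn (M.zeros r) :=
    (isClosed_vanishingOn _).mem_of_tendsto hψ (Eventually.of_forall fun j => by
      rw [Function.comp_apply, ← hφ]
      exact (φ _).2)
  refine ⟨M.ofS r ⟨ψ, hmem⟩, σ, hσ, ?_⟩
  have hlim : Tendsto (fun j => φ (σ j)) atTop (𝓝 ⟨ψ, hmem⟩) := by
    refine tendsto_subtype_rng.2 (hψ.congr fun j => ?_)
    exact (hφ (σ j)).symm
  exact (((M.ofS r).continuous.tendsto _).comp hlim).congr fun j => hφ' (σ j)

section Convolution

/-- Use the local bound with `B = 0`. The extra 1 in the radius makes the translate vanish in a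
neighbourhood of each point of the ball, so its derivatives vanish there too. -/
theorem mem_vanishingOn_of_isLocalBound {T : SpaceS n →L[ℂ] ℂ} {C : ℝ} {N : ℕ} {R : ℝ}
    (hT : IsLocalBound T C N R) {r : ℝ} {φ ζ : SpaceS n} (hφ : φ ∈ vanishingOn (M.zeros r))
    (hζ : ∀ x, ζ x = T (shift x φ)) : ζ ∈ vanishingOn (M.zeros (r + (R + 1))) := by
  intro x hx
  rw [hζ, ← norm_le_zero_iff]
  refine (hT (shift x φ) 0 le_rfl fun i _ y hy => ?_).trans (mul_zero C).le
  have h1 : ⇑(shift x φ) =ᶠ[𝓝 y] fun _ => (0 : ℂ) := by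
    filter_upwards [Metric.ball_mem_nhds y one_pos] with z hz
    rw [shift_apply]
    refine hφ _ (M.add_mem_zeros _ _ x hx z ?_)
    rw [mem_ball_iff_norm] at hz
    have := norm_add_le (z - y) y
    rw [sub_add_cancel] at this
    linarith
  rw [(h1.iteratedFDeriv ℝ i).eq_of_nhds]
  simp

variable [TranslationSpace n E]

theorem toS_translate (x : Rn n) (ξ : E) :
    M.toS (TranslationSpace.translate x ξ) = shift x (M.toS ξ) := by
  ext y
  rw [M.toS_apply, TranslationSpace.translate_apply, shift_apply, M.toS_apply]

theorem exists_eq_translate {f : E →L[ℂ] ℂ} {T : SpaceS n →L[ℂ] ℂ} {C : ℝ} {N : ℕ} {R : ℝ}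
    (hR : 0 ≤ R) (hT : IsLocalBound T C N R) (hf : ∀ ξ, f ξ = T (M.toS ξ)) :
    ∀ ξ : E, ∃ ζ : E, ∀ x : Rn n, ζ x = f (TranslationSpace.translate x ξ) := by
  intro ξ
  obtain ⟨ζ, hζ⟩ := hT.exists_conv hR (M.toS ξ)
  obtain ⟨r, hr⟩ := M.exists_zeros_apply ξ
  have hmem := M.mem_vanishingOn_of_isLocalBound hT (r := r)
    (fun x hx => by rw [M.toS_apply, hr x hx]) hζ
  refine ⟨M.ofS _ ⟨ζ, hmem⟩, fun x => ?_⟩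
  rw [M.ofS_apply, hf, toS_translate]
  exact hζ x

/-- Joint sequential continuity of the convolution, with limits taken in a fixed subspace of the
Schwartz space. -/
theorem exists_tendsto_conv {f : ℕ → E →L[ℂ] ℂ} {g : E →L[ℂ] ℂ} {T : ℕ → SpaceS n →L[ℂ] ℂ}
    {S : SpaceS n →L[ℂ] ℂ} {C : ℝ} {N : ℕ} {R : ℝ} (hR : 0 ≤ R)
    (hT : ∀ j, IsLocalBound (T j) C N R) (hS : IsLocalBound S C N R)
    (hTS : ∀ φ, Tendsto (fun j => T j φ) atTop (𝓝 (S φ))) (hf : ∀ j ξ, f j ξ = T j (M.toS ξ))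
    (hg : ∀ ξ, g ξ = S (M.toS ξ)) {ξk ζk : ℕ → E} {ξ ζ : E} (hξ : Tendsto ξk atTop (𝓝 ξ))
    (hζk : ∀ j x, ζk j x = f j (TranslationSpace.translate x (ξk j)))
    (hζ : ∀ x, ζ x = g (TranslationSpace.translate x ξ)) :
    ∃ (r : ℝ) (φk : ℕ → vanishingOn (M.zeros r)) (φ : vanishingOn (M.zeros r)),
      (∀ j, M.ofS r (φk j) = ζk j) ∧ M.ofS r φ = ζ ∧ Tendsto φk atTop (𝓝 φ) := by
  obtain ⟨r, hr, hrk⟩ := M.exists_zeros_of_tendsto hξ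
  have hk : ∀ j x, M.toS (ζk j) x = T j (shift x (M.toS (ξk j))) := fun j x => by
    rw [M.toS_apply, hζk, hf, toS_translate]
  have hl : ∀ x, M.toS ζ x = S (shift x (M.toS ξ)) := fun x => by
    rw [M.toS_apply, hζ, hg, toS_translate]
  have hlim : Tendsto (fun j => M.toS (ζk j)) atTop (𝓝 (M.toS ζ)) :=
    tendsto_conv hR hT hTS ((M.toS.continuous.tendsto ξ).comp hξ) hk hl
  have hmk : ∀ j, M.toS (ζk j) ∈ vanishingOn (M.zeros (r + (R + 1))) := fun j =>
    M.mem_vanishingOn_of_isLocalBound (hT j)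
      (fun x hx => by rw [M.toS_apply, hrk j x hx]) (hk j)
  have hm : M.toS ζ ∈ vanishingOn (M.zeros (r + (R + 1))) :=
    M.mem_vanishingOn_of_isLocalBound hS (fun x hx => by rw [M.toS_apply, hr x hx]) hl
  refine ⟨_, fun j => ⟨M.toS (ζk j), hmk j⟩, ⟨M.toS ζ, hm⟩, fun j => ?_, ?_,
    tendsto_subtype_rng.2 hlim⟩
  · exact M.toS_injective (M.toS_ofS _ _)
  · exact M.toS_injective (M.toS_ofS _ _)

theorem isConvolutionMultiplier_of_isLocalBound {f : E →L[ℂ] ℂ} {T : SpaceS n →L[ℂ] ℂ} {C : ℝ}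
    {N : ℕ} {R : ℝ} (hR : 0 ≤ R) (hT : IsLocalBound T C N R) (hf : ∀ ξ, f ξ = T (M.toS ξ)) :
    IsConvolutionMultiplier f where
  exists_eq := M.exists_eq_translate hR hT hf
  tendsto_zero ξ ζ hζ hξ := by
    obtain ⟨r, φk, φ, hk, h, hlim⟩ := M.exists_tendsto_conv hR (fun _ => hT) hT
      (fun _ => tendsto_const_nhds) (fun _ => hf) hf hξ hζ (ζ := 0) fun x => by
        rw [hf, toS_translate, ← M.toS_apply, map_zero, map_zero, map_zero]
        rfl
    have := ((M.ofS r).continuous.tendsto φ).comp hlim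
    rw [h] at this
    exact this.congr hk

/-- Convergence of convolutions with demi-distributions, for all spaces of test functions modelled
on the Schwartz space. -/
theorem convolution_demiDistributions (M : SchwartzModel n E) (fk : ℕ → E →L[ℂ] ℂ) (f : E → ℂ)
    (hf : ∀ ξ, Tendsto (fun k => fk k ξ) atTop (𝓝 (f ξ)))
    (hF : ∃ F : Set (Rn n), Bornology.IsBounded F ∧ ∀ k, Distribution.dsupport (fk k) ⊆ F)
    {γ : ℂ → ℂ} (hγ : γ ∈ C0) {U : Set E} (hU : U ∈ 𝓝 (0 : E)) (gk : ℕ → E → ℂ) (g : E → ℂ)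
    (hgk : ∀ k, gk k ∈ demiDistributions γ U) (hg : Continuous g)
    (hlim : ∀ ξ, Tendsto (fun k => gk k ξ) atTop (𝓝 (g ξ))) :
    ∃ f' : E →L[ℂ] ℂ, ⇑f' = f ∧
      ∃ (hk : ∀ k, IsConvolutionMultiplier (fk k)) (hf : IsConvolutionMultiplier f'),
        (∀ B : Set E, Bornology.IsVonNBounded ℂ B →
          TendstoUniformlyOn (fun p : ℕ × ℕ => (hk p.1).conv (gk p.2)) (hf.conv g) atTop B) ∧
        (∀ B : Set E, Bornology.IsVonNBounded ℂ B →
          TendstoUniformlyOn (fun k => (hk k).conv (gk k)) (hf.conv g) atTop B) ∧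
        (∀ (ξk : ℕ → E) (ξ : E), Tendsto ξk atTop (𝓝 ξ) →
          Tendsto (fun k => (hk k).conv (gk k) (ξk k)) atTop (𝓝 (hf.conv g ξ))) := by
  obtain ⟨F, hFb, hFk⟩ := hF
  obtain ⟨T, S, C, N, R, hR, hT, hS, hTS, hfT, hfS⟩ := M.exists_isLocalBound hf hFb hFk
  have hk : ∀ k, IsConvolutionMultiplier (fk k) := fun k =>
    M.isConvolutionMultiplier_of_isLocalBound hR (hT k) (hfT k)
  have hf' : IsConvolutionMultiplier (S.comp M.toS) :=
    M.isConvolutionMultiplier_of_isLocalBound hR hS fun _ => rfl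
  -- Two independent index sequences are needed for the double limit; `a = b = id` gives the last
  -- assertion.
  have seq : ∀ (a b : ℕ → ℕ), Tendsto a atTop atTop → Tendsto b atTop atTop →
      ∀ (ξk : ℕ → E) (ξ : E), Tendsto ξk atTop (𝓝 ξ) →
        Tendsto (fun j => (hk (a j)).conv (gk (b j)) (ξk j)) atTop (𝓝 (hf'.conv g ξ)) := by
    intro a b ha hb ξk ξ hξ
    obtain ⟨r, φk, φ, hφk, hφ, hφlim⟩ := M.exists_tendsto_conv (f := fun j => fk (a j))
      (g := S.comp M.toS) (T := fun j => T (a j)) hR (fun j => hT (a j)) hS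
      (fun φ => (hTS φ).comp ha) (fun j => hfT (a j)) (fun _ => rfl) hξ
      (fun j x => (hk (a j)).convTest_apply (ξk j) x) (hf'.convTest_apply ξ)
    have : BaireSpace (vanishingOn (M.zeros r)) := baireSpace_of_isClosed (isClosed_vanishingOn _)
    have hU' : M.ofS r ⁻¹' U ∈ 𝓝 0 :=
      (M.ofS r).continuous.continuousAt.preimage_mem_nhds (by rwa [map_zero])
    have := tendsto_apply_of_tendsto hγ hU' (gk := fun m => gk m ∘ M.ofS r) (g := g ∘ M.ofS r)
      (fun m => demiDistributions.comp (hgk m) (M.ofS r)) (fun φ => hlim _) hb hφlim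
    simpa only [Function.comp_apply, hφk, hφ, IsConvolutionMultiplier.conv] using this
  have unif : ∀ B : Set E, Bornology.IsVonNBounded ℂ B →
      TendstoUniformlyOn (fun p : ℕ × ℕ => (hk p.1).conv (gk p.2)) (hf'.conv g) atTop B := by
    intro B hB
    rw [Metric.tendstoUniformlyOn_iff]
    intro ε hε
    by_contra hcon
    obtain ⟨p, hp, hp'⟩ := exists_seq_forall_of_frequently (not_eventually.1 hcon)
    push Not at hp'
    choose ξ hξB hξ using hp'
    obtain ⟨η, σ, hσ, hη⟩ := M.exists_subseq_tendsto hB hξB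
    rw [← prod_atTop_atTop_eq, tendsto_prod_iff'] at hp
    have h1 := seq _ _ (hp.1.comp hσ.tendsto_atTop) (hp.2.comp hσ.tendsto_atTop) _ _ hη
    -- The limit convolution is itself sequentially continuous: take the constant sequence of
    -- functionals.
    have h2 : Tendsto (fun j => hf'.conv g (ξ (σ j))) atTop (𝓝 (hf'.conv g η)) := by
      obtain ⟨r, φk, φ, hφk, hφ, hφlim⟩ := M.exists_tendsto_conv hR (fun _ => hS) hS
        (fun _ => tendsto_const_nhds) (fun _ _ => rfl) (fun _ => rfl) hη
        (fun j x => hf'.convTest_apply ((ξ ∘ σ) j) x) (hf'.convTest_apply η)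
      have := ((hg.comp (M.ofS r).continuous).tendsto φ).comp hφlim
      simpa only [Function.comp_def, hφk, hφ, IsConvolutionMultiplier.conv] using this
    have h3 := h2.dist h1
    rw [dist_self] at h3
    obtain ⟨j, hj⟩ := (h3.eventually (gt_mem_nhds hε)).exists
    exact (hξ (σ j)).not_gt hj
  refine ⟨S.comp M.toS, funext fun ξ => (hfS ξ).symm, hk, hf', unif, fun B hB => ?_,
    seq id id tendsto_id tendsto_id⟩
  have hd : Tendsto (fun k : ℕ => (k, k)) atTop atTop := by
    rw [← prod_atTop_atTop_eq]
    exact tendsto_id.prodMk tendsto_id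
  intro u hu
  exact hd.eventually (unif B hB u hu)

end Convolution

end SchwartzModel

end DemiDist

/-! ### The models for `𝓢` and `𝓓` -/

namespace DemiDist

open SchwartzMap

variable {n : ℕ}

/-- Multiply by dilated cutoffs `χ (c j • x)` with `c j → 0`. Since `c j ≤ 1`, their derivatives are
bounded uniformly in `j`, and at each point the product is eventually `ζ x`, so boundedness and
pointwise convergence suffice. -/
theorem exists_hasCompactSupport_tendsto (ζ : SpaceS n) :
    ∃ ζk : ℕ → SpaceS n, (∀ j, HasCompactSupport (ζk j)) ∧
      (∀ j, tsupport (ζk j) ⊆ tsupport ζ) ∧ Tendsto ζk atTop (𝓝 ζ) := by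
  obtain ⟨χ, hχ1, hχs⟩ := SchwartzModel.exists_cutoff (n := n) (r := 1) one_pos
  let c : ℕ → ℝ := fun j => 1 / ((j : ℝ) + 1)
  have hc0 : ∀ j, 0 < c j := fun j => Nat.one_div_pos_of_nat
  have hc1 : ∀ j, c j ≤ 1 := fun j => by
    have : (0 : ℝ) ≤ j := j.cast_nonneg
    exact div_le_one_of_le₀ (by linarith) (by linarith)
  let g : ℕ → Rn n → ℂ := fun j x => χ (c j • x)
  have hχc : HasCompactSupport χ :=
    HasCompactSupport.of_support_subset_isCompact (isCompact_closedBall 0 (1 + 1))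
      ((subset_tsupport _).trans hχs)
  have hgs : ∀ j, ContDiff ℝ (⊤ : ℕ∞) (g j) := fun j =>
    (χ.smooth ⊤).comp (contDiff_id.const_smul (c j))
  have hgc : ∀ j, HasCompactSupport (g j) := fun j => hχc.comp_smul (hc0 j).ne'
  have hgb : ∀ j i y, ‖iteratedFDeriv ℝ i (g j) y‖ ≤ SchwartzMap.seminorm ℝ 0 i χ := by
    intro j i y
    have h := congrFun (iteratedFDeriv_comp_const_smul (𝕜 := ℝ) (c j)
      ((χ.smooth ⊤).of_le (m := (i : WithTop ℕ∞)) (by exact_mod_cast le_top))) y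
    rw [show g j = fun z => χ (c j • z) from rfl, h, norm_smul, norm_pow, Real.norm_eq_abs,
      abs_of_pos (hc0 j)]
    have h1 := SchwartzMap.le_seminorm ℝ 0 i χ (c j • y)
    rw [pow_zero, one_mul] at h1
    calc c j ^ i * _ ≤ 1 * ‖iteratedFDeriv ℝ i χ (c j • y)‖ := by
          gcongr
          exact pow_le_one₀ (hc0 j).le (hc1 j)
      _ ≤ _ := by rwa [one_mul]
  have hmc : ∀ j, HasCompactSupport fun x => g j x * ζ x := fun j => (hgc j).mul_right
  let ζk : ℕ → SpaceS n := fun j => (hmc j).toSchwartzMap ((hgs j).mul (ζ.smooth ⊤))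
  refine ⟨ζk, hmc, fun j => tsupport_mul_subset_right, tendsto_of_tendsto_apply ?_ fun x => ?_⟩
  · intro k i
    set A : ℝ := ∑ l ∈ Finset.range (i + 1), SchwartzMap.seminorm ℝ 0 l χ
    have hA : 0 ≤ A := Finset.sum_nonneg fun l _ => apply_nonneg _ _
    refine ⟨2 ^ i * A * ∑ l ∈ Finset.range (i + 1), SchwartzMap.seminorm ℝ k l ζ, fun j => ?_⟩
    refine SchwartzMap.seminorm_le_bound ℝ k i _
      (mul_nonneg (by positivity) (Finset.sum_nonneg fun l _ => apply_nonneg _ _)) fun y => ?_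
    have h1 := norm_iteratedFDeriv_mul_le_two_pow (hgs j) ζ i y (A := A)
      (B := ∑ l ∈ Finset.range (i + 1), ‖iteratedFDeriv ℝ l ζ y‖)
      (fun l hl => (hgb j l y).trans (Finset.single_le_sum
        (f := fun l => SchwartzMap.seminorm ℝ 0 l χ) (fun l _ => apply_nonneg _ _)
        (Finset.mem_range.2 (Nat.lt_succ_of_le hl))))
      (fun l hl => Finset.single_le_sum (f := fun l => ‖iteratedFDeriv ℝ l ζ y‖)
        (fun l _ => norm_nonneg _) (Finset.mem_range.2 (Nat.lt_succ_of_le hl)))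
    calc ‖y‖ ^ k * ‖iteratedFDeriv ℝ i (fun x => g j x * ζ x) y‖
        ≤ ‖y‖ ^ k * (2 ^ i * A * ∑ l ∈ Finset.range (i + 1), ‖iteratedFDeriv ℝ l ζ y‖) := by
          gcongr
      _ = 2 ^ i * A * ∑ l ∈ Finset.range (i + 1), ‖y‖ ^ k * ‖iteratedFDeriv ℝ l ζ y‖ := by
          rw [← Finset.mul_sum]
          ring
      _ ≤ _ := by
          gcongr with l hl
          exact SchwartzMap.le_seminorm ℝ k l ζ y
  · have hc : Tendsto (fun j => ‖c j • x‖) atTop (𝓝 0) := by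
      have := (tendsto_one_div_add_atTop_nhds_zero_nat (𝕜 := ℝ)).smul_const x
      rw [zero_smul] at this
      simpa only [norm_zero] using this.norm
    refine tendsto_const_nhds.congr' ?_
    filter_upwards [hc.eventually_lt_const one_pos] with j hj
    change ζ x = χ (c j • x) * ζ x
    rw [hχ1 _ hj.le, one_mul]

/-- The Schwartz space as a space of test functions. -/
noncomputable def schwartzModelS (n : ℕ) : SchwartzModel n (SpaceS n) where
  toS := ContinuousLinearMap.id ℂ _
  toS_apply _ _ := rfl
  -- No support condition is needed here: the subspace is all of `𝓢`.
  zeros _ := ∅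
  lt_norm _ _ h := h.elim
  add_mem_zeros _ _ _ h := h.elim
  ofS _ := (vanishingOn ∅).subtypeL
  ofS_apply _ _ _ := rfl
  exists_zeros _ _ := ⟨0, fun _ _ _ h => h.elim⟩
  exists_eq _ hθ hc := ⟨hc.toSchwartzMap hθ, rfl⟩
  exists_approx := exists_hasCompactSupport_tendsto

/-- The inclusion of `𝓓` into the Schwartz space. -/
noncomputable def testToSchwartz (n : ℕ) : SpaceD n →L[ℂ] SpaceS n :=
  TestFunction.mkCLM ℂ (fun ξ => ξ.hasCompactSupport.toSchwartzMap ξ.contDiff)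
    (fun _ _ => rfl) (fun _ _ => rfl) fun K hK => by
      obtain ⟨R, hR0, hR⟩ := K.isCompact.isBounded.exists_pos_norm_le
      let Φ : 𝓓_{K}(Rn n, ℂ) →ₗ[ℂ] SpaceS n :=
        { toFun f := f.hasCompactSupport.toSchwartzMap f.contDiff
          map_add' _ _ := rfl
          map_smul' _ _ := rfl }
      change Continuous Φ
      refine WithSeminorms.continuous_of_isBounded
        (ContDiffMapSupportedIn.withSeminorms ℂ (Rn n) ℂ ⊤ K)
        (schwartz_withSeminorms ℂ (Rn n) ℂ) _ (.of_real fun m => ⟨{m.2}, R ^ m.1, fun f => ?_⟩)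
      rw [Finset.sup_singleton]
      refine SchwartzMap.seminorm_le_bound ℂ m.1 m.2 _ (by positivity) fun x => ?_
      change ‖x‖ ^ m.1 * ‖iteratedFDeriv ℝ m.2 f x‖ ≤ _
      by_cases hx : x ∈ K
      · gcongr
        · exact hR x hx
        · exact ContDiffMapSupportedIn.norm_iteratedFDeriv_apply_le_seminorm_top ℂ
      · rw [f.iteratedFDeriv_zero_on_compl hx]
        simp only [Pi.zero_apply, norm_zero, mul_zero]
        positivity

/-- The closed ball around the origin as a compact set. -/
def closedBallCompacts (n : ℕ) (r : ℝ) : Compacts (Rn n) :=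
  ⟨Metric.closedBall 0 r, isCompact_closedBall 0 r⟩

/-- The Schwartz functions that vanish outside of a ball, as functions supported in this ball. -/
noncomputable def schwartzToSupportedIn (n : ℕ) (r : ℝ) :
    vanishingOn {x : Rn n | r < ‖x‖} →L[ℂ] 𝓓_{closedBallCompacts n r}(Rn n, ℂ) :=
  letI Φ : vanishingOn {x : Rn n | r < ‖x‖} →ₗ[ℂ] 𝓓_{closedBallCompacts n r}(Rn n, ℂ) :=
    { toFun φ := ⟨(φ : SpaceS n), (φ : SpaceS n).smooth ⊤, fun x hx => φ.2 x (by
        simpa [closedBallCompacts] using hx)⟩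
      map_add' _ _ := rfl
      map_smul' _ _ := rfl }
  { toLinearMap := Φ
    cont := by
      change Continuous Φ
      refine WithSeminorms.continuous_of_isBounded
        (IsInducing.subtypeVal.withSeminorms (schwartz_withSeminorms ℂ (Rn n) ℂ)
          (f := (vanishingOn {x : Rn n | r < ‖x‖}).subtype))
        (ContDiffMapSupportedIn.withSeminorms ℂ (Rn n) ℂ ⊤ _) _
        (.of_real fun i => ⟨{(0, i)}, 1, fun φ => ?_⟩)
      rw [Finset.sup_singleton, one_mul]
      refine (ContDiffMapSupportedIn.seminorm_top_le_iff ℂ (apply_nonneg _ _) i _).2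
        fun x _ => ?_
      exact SchwartzMap.norm_iteratedFDeriv_le_seminorm ℂ (φ : SpaceS n) i x }

/-- The Schwartz functions that vanish outside of a ball, as elements of `𝓓`. -/
noncomputable def schwartzToTest (n : ℕ) (r : ℝ) :
    vanishingOn {x : Rn n | r < ‖x‖} →L[ℂ] SpaceD n :=
  (TestFunction.ofSupportedInCLM ℂ (K := closedBallCompacts n r)
    (Ω := (⊤ : Opens (Rn n))) (Set.subset_univ _)).comp (schwartzToSupportedIn n r)

theorem norm_mul_eval_le {a : ℕ → ℂ} {x : ℕ → Rn n} (hx : ∀ m : ℕ, m < ‖x m‖) {ξ : Rn n → ℂ}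
    {R C : ℝ} (hR : ∀ y, R < ‖y‖ → ξ y = 0) (hC : ∀ y, ‖ξ y‖ ≤ C) (m : ℕ) :
    ‖a m * ξ (x m)‖ ≤ (∑ l ∈ Finset.range (⌈R⌉₊ + 1), ‖a l‖) * C := by
  have hC0 : 0 ≤ C := (norm_nonneg _).trans (hC 0)
  rw [norm_mul]
  by_cases hm : m ∈ Finset.range (⌈R⌉₊ + 1)
  · gcongr
    · exact Finset.single_le_sum (f := fun l => ‖a l‖) (fun _ _ => norm_nonneg _) hm
    · exact hC _
  · have : R < m := by
      rw [Finset.mem_range, not_lt] at hm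
      calc R ≤ ⌈R⌉₊ := Nat.le_ceil R
        _ < m := by exact_mod_cast hm
    rw [hR _ (this.trans (hx m)), norm_zero, mul_zero]
    positivity

/-- The points escape to infinity, so functions supported in a fixed compact set meet only finitely
many of them. Hence arbitrary weights give a continuous map, which detects sets without a common
compact support. -/
theorem exists_weightedEval {x : ℕ → Rn n} (hx : ∀ m : ℕ, m < ‖x m‖) (a : ℕ → ℂ) :
    ∃ L : SpaceD n →L[ℂ] BoundedContinuousFunction ℕ ℂ, ∀ ξ m, L ξ m = a m * ξ (x m) := by
  have hb : ∀ ξ : SpaceD n, ∃ C, ∀ m, ‖a m * ξ (x m)‖ ≤ C := fun ξ => by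
    obtain ⟨C, hC⟩ := ξ.hasCompactSupport.exists_bound_of_continuous ξ.continuous
    obtain ⟨R, hR⟩ := ξ.hasCompactSupport.isCompact.isBounded.exists_norm_le
    exact ⟨_, norm_mul_eval_le hx (fun y hy => image_eq_zero_of_notMem_tsupport fun h =>
      (hR y h).not_gt hy) hC⟩
  refine ⟨TestFunction.mkCLM ℂ (fun ξ => BoundedContinuousFunction.ofNormedAddCommGroupDiscrete
    (fun m => a m * ξ (x m)) (hb ξ).choose (hb ξ).choose_spec) (fun ξ η => ?_) (fun t ξ => ?_)
    fun K hK => ?_, fun _ _ => rfl⟩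
  · ext m
    exact mul_add _ _ _
  · ext m
    exact mul_left_comm _ _ _
  · obtain ⟨R, hR⟩ := K.isCompact.isBounded.exists_norm_le
    refine (ContDiffMapSupportedIn.mkCLMtoNormedSpace (𝕜 := ℂ) (fun f : 𝓓_{K}(Rn n, ℂ) =>
      BoundedContinuousFunction.ofNormedAddCommGroupDiscrete (fun m => a m * f (x m))
      (hb (TestFunction.ofSupportedIn hK f)).choose
      (hb (TestFunction.ofSupportedIn hK f)).choose_spec) (fun ξ η => ?_) (fun t ξ => ?_)
      ⟨{0}, ∑ l ∈ Finset.range (⌈R⌉₊ + 1), ‖a l‖, by positivity, fun f => ?_⟩).continuous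
    · ext m
      exact mul_add _ _ _
    · ext m
      exact mul_left_comm _ _ _
    · rw [Finset.sup_singleton, BoundedContinuousFunction.norm_le (by positivity)]
      exact norm_mul_eval_le hx (fun y hy => f.zero_on_compl fun h => (hR y h).not_gt hy)
        fun y => ContDiffMapSupportedIn.norm_apply_le_seminorm ℂ

/-- The space `𝓓` as a space of test functions. -/
noncomputable def schwartzModelD (n : ℕ) : SchwartzModel n (SpaceD n) where
  toS := testToSchwartz n
  toS_apply _ _ := rfl
  zeros r := {x | r < ‖x‖}
  lt_norm _ _ h := h
  add_mem_zeros r R x hx y hy := by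
    have h := norm_sub_le (x + y) y
    rw [add_sub_cancel_right] at h
    simp only [Set.mem_ofPred_eq] at hx ⊢
    linarith
  ofS := schwartzToTest n
  ofS_apply _ _ _ := rfl
  exists_zeros B hB := by
    by_contra! hcon
    choose ξ hξB x hx hξx using fun m : ℕ => hcon m
    -- The weights make the `m`-th coordinate of `L (ξ m)` equal to `m`, so `L '' B` is unbounded.
    obtain ⟨L, hL⟩ := exists_weightedEval hx fun m => m / ξ m (x m)
    obtain ⟨C, hC⟩ := (hB L).exists_norm_le
    obtain ⟨m, hm⟩ := exists_nat_gt C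
    have h1 := hC _ ⟨ξ m, hξB m, rfl⟩
    have h2 := (L (ξ m)).norm_coe_le_norm m
    rw [hL, div_mul_cancel₀ _ (hξx m), Complex.norm_natCast] at h2
    linarith
  exists_eq θ hθ hc := ⟨⟨θ, hθ, hc, fun _ _ => trivial⟩, rfl⟩
  exists_approx ζ := ⟨fun _ => ζ, fun _ => ζ.hasCompactSupport, fun _ => subset_rfl,
    tendsto_const_nhds⟩

end DemiDist

theorem theorem4p6 (n : ℕ) :
    -- The case `E = 𝓓`.
    (∀ (fk : ℕ → SpaceD n →L[ℂ] ℂ) (f : SpaceD n → ℂ),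
      (∀ ξ : SpaceD n, Tendsto (fun k => fk k ξ) atTop (𝓝 (f ξ))) →
      (∃ F : Set (Rn n), Bornology.IsBounded F ∧ ∀ k, Distribution.dsupport (fk k) ⊆ F) →
      ∀ γ ∈ C0, ∀ U ∈ 𝓝 (0 : SpaceD n), ∀ (gk : ℕ → SpaceD n → ℂ) (g : SpaceD n → ℂ),
      (∀ k, gk k ∈ demiDistributions γ U) → g ∈ demiDistributions γ U →
      (∀ ξ : SpaceD n, Tendsto (fun k => gk k ξ) atTop (𝓝 (g ξ))) →
      ∃ f' : SpaceD n →L[ℂ] ℂ, ⇑f' = f ∧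
        ∃ (hk : ∀ k, IsConvolutionMultiplier (fk k)) (hf : IsConvolutionMultiplier f'),
          (∀ B : Set (SpaceD n), Bornology.IsVonNBounded ℂ B →
            TendstoUniformlyOn (fun p : ℕ × ℕ => (hk p.1).conv (gk p.2)) (hf.conv g) atTop B) ∧
          (∀ B : Set (SpaceD n), Bornology.IsVonNBounded ℂ B →
            TendstoUniformlyOn (fun k => (hk k).conv (gk k)) (hf.conv g) atTop B) ∧
          (∀ (ξk : ℕ → SpaceD n) (ξ : SpaceD n), Tendsto ξk atTop (𝓝 ξ) →
            Tendsto (fun k => (hk k).conv (gk k) (ξk k)) atTop (𝓝 (hf.conv g ξ)))) ∧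
    -- The case `E = 𝓢`.
    (∀ (fk : ℕ → SpaceS n →L[ℂ] ℂ) (f : SpaceS n → ℂ),
      (∀ ξ : SpaceS n, Tendsto (fun k => fk k ξ) atTop (𝓝 (f ξ))) →
      (∃ F : Set (Rn n), Bornology.IsBounded F ∧ ∀ k, Distribution.dsupport (fk k) ⊆ F) →
      ∀ γ ∈ C0, ∀ U ∈ 𝓝 (0 : SpaceS n), ∀ (gk : ℕ → SpaceS n → ℂ) (g : SpaceS n → ℂ),
      (∀ k, gk k ∈ demiDistributions γ U) → g ∈ demiDistributions γ U →
      (∀ ξ : SpaceS n, Tendsto (fun k => gk k ξ) atTop (𝓝 (g ξ))) →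
      ∃ f' : SpaceS n →L[ℂ] ℂ, ⇑f' = f ∧
        ∃ (hk : ∀ k, IsConvolutionMultiplier (fk k)) (hf : IsConvolutionMultiplier f'),
          (∀ B : Set (SpaceS n), Bornology.IsVonNBounded ℂ B →
            TendstoUniformlyOn (fun p : ℕ × ℕ => (hk p.1).conv (gk p.2)) (hf.conv g) atTop B) ∧
          (∀ B : Set (SpaceS n), Bornology.IsVonNBounded ℂ B →
            TendstoUniformlyOn (fun k => (hk k).conv (gk k)) (hf.conv g) atTop B) ∧
          (∀ (ξk : ℕ → SpaceS n) (ξ : SpaceS n), Tendsto ξk atTop (𝓝 ξ) →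
            Tendsto (fun k => (hk k).conv (gk k) (ξk k)) atTop (𝓝 (hf.conv g ξ)))) := by

  exact ⟨fun fk f hf hF _ hγ _ hU gk g hgk hg hlim =>
    (schwartzModelD n).convolution_demiDistributions fk f hf hF hγ hU gk g hgk hg.1 hlim,
    fun fk f hf hF _ hγ _ hU gk g hgk hg hlim =>
    (schwartzModelS n).convolution_demiDistributions fk f hf hF hγ hU gk g hgk hg.1 hlim⟩
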